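/- Let $1<\nu<\infty$. For $x\in\mathbb R$ and $\theta=(\mu,\sigma)\in\Theta:=\mathbb R\times(0,\infty)$ let $$\rho_\nu(x,\theta)=\log\sigma+\frac{\nu+1}{2}\log\Bigl(1+\frac{(x-\mu)^2}{\nu\sigma^2}\Bigr),\qquad h_\nu(x,\theta)=\rho_\nu(x,\theta)-\rho_\nu(x,(0,1))=\log\sigma+\frac{\nu+1}{2}\log\frac{1+(x-\mu)^2/(\nu\sigma^2)}{1+x^2/\nu}.$$ For each $\theta\in\Theta$ the function $h_\nu(\cdot,\theta)$ is integrable for every law (Borel probability measure) $Q$ on $\mathbb R$; put $Qh_\nu(\theta)=\int h_\nu(x,\theta)\,dQ(x)$. Definitions. A point $\theta_1\in\Theta$ is the M-functional of $Q$ for $\rho_\nu$ if for some measurable $a:\mathbb R\to\mathbb R$ the integral $\int(\rho_\nu(x,\theta)-a(x))\,dQ(x)$ is defined and $>-\infty$ for all $\theta\in\Theta$, and is minimized over $\Theta$ uniquely at $\theta_1$. A point $\theta_0\in\overline\Theta:=\mathbb R\times[0,\infty)$ is the extended M-functional of $Q$ for $h_\nu$ if for every neighborhood $U$ of $\theta_0$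 $$-\infty\le\liminf_{\phi\to\theta_0,\ \phi\in\Theta}Qh_\nu(\phi)\;<\;\inf_{\phi\in\Theta,\ \phi\notin U}Qh_\nu(\phi).$$ The maximum likelihood estimate for observations $x_1,\dots,x_n$ ($n\ge1$) is the point $\hat\theta_n\in\overline\Theta$ such that, for every neighborhood $U$ of $\hat\theta_n$, $$\sup_{\phi\in\Theta,\ \phi\notin U}\ell_n(\phi)<\limsup_{\phi\to\hat\theta_n,\ \phi\in\Theta}\ell_n(\phi)\le+\infty,$$ where $\ell_n(\phi)$ is the log likelihood of $x_1,\dots,x_n$ under the $t_\nu$ density with location and scale parameters $\phi=(\mu,\sigma)$. Let $BL(\mathbb R)$ be the space of bounded Lipschitz functions on $\mathbb R$ with norm $\|f\|_{BL}=\sup|f|+\sup_{x\ne y}|f(x)-f(y)|/|x-y|$, let $X$ be its dual Banach space, and for a law $Q$ let $\phi_Q\in X$, $\phi_Q(f)=\int f\,dQ$. A functional $T$ on a set $D$ of laws is analytic for the dual-bounded-Lipschitz norm if there are an open set $O\subset X$ containing all $\phi_Q$, $Q\in D$, and an analytic function $G$ on $O$ with $G(\phi_Q)=T(Q)$ for all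 $Q\in D$. **Theorem 9.1.** Let $1<\nu<\infty$. (a) For any law $Q$ on $\mathbb R$ with $Q(\{t\})<\nu/(\nu+1)$ for all $t\in\mathbb R$, the M-functional $(\mu_\nu,\sigma_\nu)(Q)$ exists with $\sigma_\nu(Q)>0$, agrees with the extended M-functional, and is the unique critical point of $Qh_\nu$ on $\Theta$, that is, the unique point where $\partial Qh_\nu/\partial\mu=\partial Qh_\nu/\partial\sigma=0$. On the set of these laws $(\mu_\nu,\sigma_\nu)$ is analytic for the dual-bounded-Lipschitz norm, and thus weakly continuous. (b) For any law $Q$ on $\mathbb R$ the extended M-functional $\theta_0(Q)=(\mu_\nu,\sigma_\nu)(Q)\in\overline\Theta$ for $h_\nu$ exists and is unique. (c) If $Q(\{s\})\ge\nu/(\nu+1)$ for some $s\in\mathbb R$, then $\theta_0(Q)=(s,0)$ (so $s$ is unique). (d) The map $Q\mapsto\theta_0(Q)$ is weakly continuous at every law $Q$. If $X_1,X_2,\dots$ are i.i.d. with law $Q$, and $Q_n=n^{-1}\sum_{j=1}^n\delta_{X_j}$, then for every $n\ge1$ the maximum likelihood estimate $\hat\theta_n$ for $X_1,\dots,X_n$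 exists and equals $\theta_0(Q_n)$, and $\hat\theta_n\to\theta_0(Q)$ almost surely as $n\to\infty$. -/

import Mathlib

open MeasureTheory ProbabilityTheory Filter Topology

/-! ### Integrals with values in `[-∞, +∞]` and M-functionals of location and scale -/

/-- The integral `Q f = ∫ f dQ` as an extended real number: the integral of the positive part
minus that of the negative part.  It is meaningful when these are not both infinite
(`ExtIntegralDefined`). -/
noncomputable def extIntegral (Q : Measure ℝ) (f : ℝ → ℝ) : EReal :=
  ((∫⁻ x, ENNReal.ofReal (f x) ∂Q : ENNReal) : EReal) -
    ((∫⁻ x, ENNReal.ofReal (-f x) ∂Q : ENNReal) : EReal)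

/-- The integral is defined, i.e. it is not of the form `∞ - ∞`. -/
def ExtIntegralDefined (Q : Measure ℝ) (f : ℝ → ℝ) : Prop :=
  AEMeasurable f Q ∧
    (∫⁻ x, ENNReal.ofReal (f x) ∂Q ≠ ⊤ ∨ ∫⁻ x, ENNReal.ofReal (-f x) ∂Q ≠ ⊤)

/-- The parameter space `Θ = ℝ × (0, ∞)` of pairs `(μ, σ)`. -/
def locScale : Set (ℝ × ℝ) := {p | 0 < p.2}

/-- The closed parameter space `ℝ × [0, ∞)`. -/
def locScaleClosure : Set (ℝ × ℝ) := {p | 0 ≤ p.2}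

/-- `θ ∈ Θ` is the M-functional of `Q` for `ρ`: for some measurable adjustment function `a`,
with `h(x, φ) = ρ(x, φ) - a(x)`, the integral `Q h(φ)` is defined and `> -∞` for all `φ ∈ Θ`,
and it is minimized over `Θ` uniquely at `θ`. -/
def IsMFunctional (ρ : ℝ → ℝ × ℝ → ℝ) (Q : Measure ℝ) (θ : ℝ × ℝ) : Prop :=
  θ ∈ locScale ∧ ∃ a : ℝ → ℝ, Measurable a ∧
    (∀ φ ∈ locScale, ExtIntegralDefined Q (fun x => ρ x φ - a x) ∧
      ⊥ < extIntegral Q (fun x => ρ x φ - a x)) ∧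
    ∀ φ ∈ locScale, φ ≠ θ →
      extIntegral Q (fun x => ρ x θ - a x) < extIntegral Q (fun x => ρ x φ - a x)

/-- `θ ∈ ℝ × [0, ∞)` is the extended M-functional of `Q` for `h`: for every neighborhood `U`
of `θ`, the lower limit of `Q h(φ)` as `φ → θ` within `Θ` (it may be `-∞`) is strictly smaller
than the infimum of `Q h` over `Θ ∖ U`. -/
def IsExtMFunctional (h : ℝ → ℝ × ℝ → ℝ) (Q : Measure ℝ) (θ : ℝ × ℝ) : Prop :=
  θ ∈ locScaleClosure ∧
    (∀ φ ∈ locScale, ExtIntegralDefined Q (fun x => h x φ)) ∧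
    ∀ U ∈ 𝓝 θ,
      liminf (fun φ => extIntegral Q (fun x => h x φ)) (𝓝[locScale] θ) <
        ⨅ φ ∈ locScale \ U, extIntegral Q (fun x => h x φ)

/-! ### The `t_ν` location-scale family on the line -/

/-- `ρ_ν(x, (μ, σ)) = log σ + ((ν + 1) / 2) log (1 + (x - μ)² / (ν σ²))`. -/
noncomputable def rhoT (ν x : ℝ) (θ : ℝ × ℝ) : ℝ :=
  Real.log θ.2 + (ν + 1) / 2 * Real.log (1 + (x - θ.1) ^ 2 / (ν * θ.2 ^ 2))

/-- `h_ν`, which is `ρ_ν(x, θ) - ρ_ν(x, (0, 1))`. -/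
noncomputable def hT (ν x : ℝ) (θ : ℝ × ℝ) : ℝ :=
  Real.log θ.2 +
    (ν + 1) / 2 * Real.log ((1 + (x - θ.1) ^ 2 / (ν * θ.2 ^ 2)) / (1 + x ^ 2 / ν))

/-- `Q h_ν`, as a real function of `θ = (μ, σ)`. -/
noncomputable def meanHT (ν : ℝ) (Q : Measure ℝ) (θ : ℝ × ℝ) : ℝ := ∫ x, hT ν x θ ∂Q

/-- The density of the `t_ν` distribution with location `μ` and scale `σ`, `θ = (μ, σ)`. -/
noncomputable def tDensity (ν : ℝ) (θ : ℝ × ℝ) (x : ℝ) : ℝ :=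
  Real.Gamma ((ν + 1) / 2) / (Real.sqrt (ν * Real.pi) * Real.Gamma (ν / 2) * θ.2) *
    (1 + (x - θ.1) ^ 2 / (ν * θ.2 ^ 2)) ^ (-((ν + 1) / 2))

/-- The log likelihood of the parameter `θ` for the first `n` terms of the sequence `x`. -/
noncomputable def logLikelihood (ν : ℝ) (x : ℕ → ℝ) (n : ℕ) (θ : ℝ × ℝ) : ℝ :=
  ∑ i ∈ Finset.range n, Real.log (tDensity ν θ (x i))

/-- `θ ∈ ℝ × [0, ∞)` is the maximum likelihood estimate of `(μ, σ)` for the first `n` terms of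
`x`, in the upper limit sense: for each neighborhood `U` of `θ`, the upper limit of the log
likelihood at `θ` (possibly `+∞`) is strictly larger than its supremum over `Θ ∖ U`. If `0 < θ.2`
this says that the likelihood is maximal at `θ`, and well separated from its other values. -/
def IsMaxLikelihoodEstimate (ν : ℝ) (x : ℕ → ℝ) (n : ℕ) (θ : ℝ × ℝ) : Prop :=
  θ ∈ locScaleClosure ∧ ∀ U ∈ 𝓝 θ,
    (⨆ φ ∈ locScale \ U, (logLikelihood ν x n φ : EReal)) <
      limsup (fun φ => (logLikelihood ν x n φ : EReal)) (𝓝[locScale] θ)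

/-- The empirical law of `x 0, …, x n`, i.e. of the first `n + 1` terms of the sequence:
`(n + 1)⁻¹ ∑ δ_{x i}`. -/
noncomputable def empiricalLaw (x : ℕ → ℝ) (n : ℕ) : ProbabilityMeasure ℝ :=
  ⟨((n + 1 : ℕ) : ENNReal)⁻¹ • ∑ i ∈ Finset.range (n + 1), Measure.dirac (x i), ⟨by
    simp only [Measure.smul_apply, Measure.finsetSum_apply, measure_univ, Finset.sum_const,
      Finset.card_range, smul_eq_mul, nsmul_eq_mul, mul_one]
    exact ENNReal.inv_mul_cancel (by simp) (ENNReal.natCast_ne_top _)⟩⟩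

/-! ### Bounded Lipschitz functions and the dual bounded Lipschitz norm -/

/-- The vector space of bounded Lipschitz functions on the line. -/
def blSubmodule : Submodule ℝ (ℝ → ℝ) where
  carrier := {f | (∃ C, ∀ x, |f x| ≤ C) ∧ ∃ L, ∀ x y, |f x - f y| ≤ L * |x - y|}
  add_mem' := by
    rintro f g ⟨⟨C, hC⟩, L, hL⟩ ⟨⟨D, hD⟩, M, hM⟩
    refine ⟨⟨C + D, fun x => (abs_add_le _ _).trans (add_le_add (hC x) (hD x))⟩, L + M, ?_⟩
    intro x y
    have : (f + g) x - (f + g) y = (f x - f y) + (g x - g y) := by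
      simp only [Pi.add_apply]; ring
    rw [this, add_mul]
    exact (abs_add_le _ _).trans (add_le_add (hL x y) (hM x y))
  zero_mem' := ⟨⟨0, by simp⟩, 0, by simp⟩
  smul_mem' := by
    rintro c f ⟨⟨C, hC⟩, L, hL⟩
    refine ⟨⟨|c| * C, fun x => ?_⟩, |c| * L, fun x y => ?_⟩
    · simp only [Pi.smul_apply, smul_eq_mul, abs_mul]
      exact mul_le_mul_of_nonneg_left (hC x) (abs_nonneg c)
    · simp only [Pi.smul_apply, smul_eq_mul, ← mul_sub, abs_mul, mul_assoc]
      exact mul_le_mul_of_nonneg_left (hL x y) (abs_nonneg c)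

/-- The space `BL(ℝ)` of bounded Lipschitz functions; its norm is defined below. -/
def BL : Type := blSubmodule

instance : AddCommGroup BL := inferInstanceAs (AddCommGroup blSubmodule)

instance : Module ℝ BL := inferInstanceAs (Module ℝ blSubmodule)

instance : CoeFun BL (fun _ => ℝ → ℝ) := ⟨fun f => Subtype.val f⟩

theorem BL.add_apply (f g : BL) (x : ℝ) : (f + g) x = f x + g x := rfl

theorem BL.smul_apply (c : ℝ) (f : BL) (x : ℝ) : (c • f) x = c * f x := rfl

/-- The bounded Lipschitz norm `sup |f| + sup_{x ≠ y} |f x - f y| / |x - y|`. The pairs with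
`x = y`, which contribute `0 / 0 = 0`, do not change the second supremum. -/
noncomputable instance : Norm BL where
  norm f := (⨆ x : ℝ, |f x|) + ⨆ p : ℝ × ℝ, |f p.1 - f p.2| / |p.1 - p.2|

theorem BL.norm_def (f : BL) :
    ‖f‖ = (⨆ x : ℝ, |f x|) + ⨆ p : ℝ × ℝ, |f p.1 - f p.2| / |p.1 - p.2| := rfl

theorem BL.bddAbove_abs (f : BL) : BddAbove (Set.range fun x : ℝ => |f x|) := by
  obtain ⟨C, hC⟩ := f.2.1
  exact ⟨C, by rintro _ ⟨x, rfl⟩; exact hC x⟩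

theorem BL.bddAbove_slope (f : BL) :
    BddAbove (Set.range fun p : ℝ × ℝ => |f p.1 - f p.2| / |p.1 - p.2|) := by
  obtain ⟨L, hL⟩ := f.2.2
  refine ⟨max L 0, ?_⟩
  rintro _ ⟨p, rfl⟩
  rcases eq_or_ne p.1 p.2 with h | h
  · simp [h]
  · have : 0 < |p.1 - p.2| := abs_pos.2 (sub_ne_zero.2 h)
    exact ((div_le_iff₀ this).2 (hL p.1 p.2)).trans (le_max_left _ _)

theorem BL.iSup_abs_nonneg (f : BL) : 0 ≤ ⨆ x : ℝ, |f x| :=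
  Real.iSup_nonneg fun _ => abs_nonneg _

theorem BL.iSup_slope_nonneg (f : BL) :
    0 ≤ ⨆ p : ℝ × ℝ, |f p.1 - f p.2| / |p.1 - p.2| :=
  Real.iSup_nonneg fun _ => by positivity

theorem BL.abs_apply_le (f : BL) (x : ℝ) : |f x| ≤ ‖f‖ :=
  (le_ciSup f.bddAbove_abs x).trans (le_add_of_nonneg_right f.iSup_slope_nonneg)

theorem BL.normCore : NormedSpace.Core ℝ BL where
  norm_nonneg f := add_nonneg f.iSup_abs_nonneg f.iSup_slope_nonneg
  norm_smul c f := by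
    simp only [BL.norm_def, BL.smul_apply, ← mul_sub, abs_mul, mul_div_assoc, Real.norm_eq_abs,
      mul_add, Real.mul_iSup_of_nonneg (abs_nonneg c)]
  norm_triangle f g := by
    have h1 : (⨆ x : ℝ, |(f + g) x|) ≤ (⨆ x : ℝ, |f x|) + ⨆ x : ℝ, |g x| :=
      ciSup_le fun x => (abs_add_le _ _).trans
        (add_le_add (le_ciSup f.bddAbove_abs x) (le_ciSup g.bddAbove_abs x))
    have h2 : (⨆ p : ℝ × ℝ, |(f + g) p.1 - (f + g) p.2| / |p.1 - p.2|) ≤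
        (⨆ p : ℝ × ℝ, |f p.1 - f p.2| / |p.1 - p.2|) +
          ⨆ p : ℝ × ℝ, |g p.1 - g p.2| / |p.1 - p.2| := by
      refine ciSup_le fun p => le_trans ?_
        (add_le_add (le_ciSup f.bddAbove_slope p) (le_ciSup g.bddAbove_slope p))
      rw [← add_div]
      refine div_le_div_of_nonneg_right ?_ (abs_nonneg _)
      rw [BL.add_apply, BL.add_apply, add_sub_add_comm]
      exact abs_add_le _ _
    simp only [BL.norm_def]
    linarith
  norm_eq_zero_iff f := by
    constructor
    · intro h
      refine Subtype.ext (funext fun x => ?_)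
      exact abs_nonpos_iff.1 ((f.abs_apply_le x).trans h.le)
    · rintro rfl
      have h0 : ∀ x : ℝ, (0 : BL) x = 0 := fun _ => rfl
      simp [BL.norm_def, h0]

noncomputable instance : NormedAddCommGroup BL := NormedAddCommGroup.ofCore BL.normCore

noncomputable instance : NormedSpace ℝ BL := NormedSpace.ofCore BL.normCore

theorem BL.continuous (f : BL) : Continuous (f : ℝ → ℝ) := by
  obtain ⟨L, hL⟩ := f.2.2
  refine (LipschitzWith.of_dist_le_mul (K := (max L 0).toNNReal) fun x y => ?_).continuous
  rw [Real.coe_toNNReal _ (le_max_right _ _), Real.dist_eq, Real.dist_eq]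
  exact (hL x y).trans (mul_le_mul_of_nonneg_right (le_max_left _ _) (abs_nonneg _))

theorem BL.integrable (f : BL) (Q : ProbabilityMeasure ℝ) :
    Integrable (f : ℝ → ℝ) (Q : Measure ℝ) :=
  Integrable.of_bound f.continuous.aestronglyMeasurable ‖f‖ (ae_of_all _ fun x => f.abs_apply_le x)

theorem BL.norm_integral_le (f : BL) (Q : ProbabilityMeasure ℝ) :
    ‖∫ x, f x ∂(Q : Measure ℝ)‖ ≤ 1 * ‖f‖ := by
  have := norm_integral_le_of_norm_le_const (μ := (Q : Measure ℝ)) (f := (f : ℝ → ℝ))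
    (ae_of_all _ fun x => f.abs_apply_le x)
  simpa using this

/-- The law `Q` as the element `f ↦ ∫ f dQ` of the dual Banach space of `BL(ℝ)`. The norm of this
dual space is the dual bounded Lipschitz norm. -/
noncomputable def lawFunctional (Q : ProbabilityMeasure ℝ) : BL →L[ℝ] ℝ :=
  LinearMap.mkContinuous
    { toFun := fun f => ∫ x, f x ∂(Q : Measure ℝ)
      map_add' := fun f g => integral_add (f.integrable Q) (g.integrable Q)
      map_smul' := fun c f => integral_const_mul c _ } 1 fun f => f.norm_integral_le Q

/-- `T` is analytic, for the dual bounded Lipschitz norm, on the set `D` of laws: it is the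
restriction to `D` of an analytic function on an open subset of the dual space of `BL(ℝ)`. -/
def AnalyticForDualBL (T : ProbabilityMeasure ℝ → ℝ × ℝ) (D : Set (ProbabilityMeasure ℝ)) :
    Prop :=
  ∃ (O : Set (BL →L[ℝ] ℝ)) (G : (BL →L[ℝ] ℝ) → ℝ × ℝ), IsOpen O ∧ AnalyticOnNhd ℝ G O ∧
    ∀ Q ∈ D, lawFunctional Q ∈ O ∧ G (lawFunctional Q) = T Q

/-- The laws all of whose atoms have mass `< ν / (ν + 1)`. -/
def smallAtomLaws (ν : ℝ) : Set (ProbabilityMeasure ℝ) :=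
  {Q | ∀ t : ℝ, (Q : Measure ℝ).real {t} < ν / (ν + 1)}

/-! In the coordinates `(μ, √ν σ)` the parameter space is the hyperbolic upper half-plane, whose
geodesics are vertical lines and half-circles centered on the boundary. Up to a term free of θ,
`h_ν` is `(ν+1)/2 · log (quadT / σ) - (ν-1)/2 · log σ`. The first term is convex along every
geodesic, being the logarithm of `A e^t + B e^(-t)`. Along a half-circle `-log σ` is `log cosh t`
plus a constant, so `ν > 1` makes `Q h_ν` strictly convex there
(`strictConvexOn_meanHT_halfCircle`); along a vertical line it is at least convex. Hence critical
points are unique unless `Q` is a point mass (`IsCriticalT.eq`).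

Existence and continuity come from one compactness argument. Let `Q_i → Q` weakly and let `φ_i`
nearly minimize `Q_i h_ν`. Along an ultrafilter `φ_i` tends to an interior point, to a boundary
point `(b, 0)`, or to infinity. Since `h_ν` is bounded in `x`, `Q h_ν` is jointly continuous in law
and parameter, so an interior limit is a minimizer. In the other cases convexity on the geodesic
from a fixed point to `φ_i` survives in the limit: `Q h_ν` is monotone in σ on the vertical line
over `b`, respectively antitone over `0`. The sign of its σ-derivative bounds `∫ νσ² / quadT dQ`
against `ν/(ν+1)`. Letting `σ → 0` gives `Q {b} ≥ ν/(ν+1)` (`boundary_limit`), while letting `σ →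
∞`, where the integral tends to 1, excludes escape to infinity (`not_tendsto_infinity`). A large
atom in turn excludes critical points (`not_isCriticalT_of_atom`). So all approximate minimizers
converge to `thetaT ν Q` (`tendsto_approximate_minimizers`), which gives the extended M-functional,
weak continuity and, since the log likelihood is affine in `Q_n h_ν`, the maximum likelihood
estimate. Consistency follows from weak convergence of the empirical laws.

For analyticity the two critical equations are extended to the dual of `BL`: dividing by the
quadratic is inverting a multiplication operator, an analytic operation (`contDiffAt_scoreMap`). At
a critical point the θ-derivative of the equations is injective (`scores_derivative_injective`), so
the implicit function theorem gives local analytic branches, which agree by uniqueness of critical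
points and are glued (`exists_analytic_gluing`). -/

/-! ### Bounds for `h_ν` uniform in `x`, and joint continuity of `Q h_ν` -/

/-- The quadratic `(x - μ)² + ν σ²` in `x` attached to `θ = (μ, σ)`. -/
def quadT (ν x : ℝ) (θ : ℝ × ℝ) : ℝ := (x - θ.1) ^ 2 + ν * θ.2 ^ 2

theorem quadT_pos {ν : ℝ} (hν : 0 < ν) (x : ℝ) {θ : ℝ × ℝ} (hθ : 0 < θ.2) : 0 < quadT ν x θ := by
  unfold quadT; positivity

theorem continuous_quadT (ν : ℝ) (θ : ℝ × ℝ) : Continuous fun x => quadT ν x θ := by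
  unfold quadT; fun_prop

theorem hT_eq {ν : ℝ} (hν : 0 < ν) (x : ℝ) {θ : ℝ × ℝ} (hθ : 0 < θ.2) :
    hT ν x θ = -ν * Real.log θ.2 +
      (ν + 1) / 2 * (Real.log (quadT ν x θ) - Real.log (ν + x ^ 2)) := by
  have hD := quadT_pos hν x hθ
  have h2 : 0 < ν + x ^ 2 := by positivity
  have h1 : (1 + (x - θ.1) ^ 2 / (ν * θ.2 ^ 2)) / (1 + x ^ 2 / ν) =
      quadT ν x θ / (θ.2 ^ 2 * (ν + x ^ 2)) := by
    unfold quadT; field_simp; ring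
  rw [hT, h1, Real.log_div hD.ne' (by positivity), Real.log_mul (by positivity) h2.ne',
    Real.log_pow]
  push_cast; ring

theorem rhoT_eq {ν : ℝ} (hν : 0 < ν) (x : ℝ) {θ : ℝ × ℝ} (hθ : 0 < θ.2) :
    rhoT ν x θ - rhoT ν x (0, 1) = hT ν x θ := by
  have h1 : 0 < 1 + (x - θ.1) ^ 2 / (ν * θ.2 ^ 2) := by positivity
  have h2 : 0 < 1 + x ^ 2 / ν := by positivity
  simp only [rhoT, hT, Real.log_div h1.ne' h2.ne', Real.log_one, sub_zero, one_pow, mul_one]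
  ring

theorem hT_base {ν : ℝ} (hν : 0 < ν) (x : ℝ) : hT ν x (0, 1) = 0 := by
  rw [← rhoT_eq hν x (by norm_num), sub_self]

theorem continuous_hT {ν : ℝ} (hν : 0 < ν) {θ : ℝ × ℝ} (hθ : 0 < θ.2) :
    Continuous fun x => hT ν x θ := by
  have h : (fun x => hT ν x θ) = fun x => -ν * Real.log θ.2 +
      (ν + 1) / 2 * (Real.log (quadT ν x θ) - Real.log (ν + x ^ 2)) :=
    funext fun x => hT_eq hν x hθ
  rw [h]
  have h1 := (continuous_quadT ν θ).log fun x => (quadT_pos hν x hθ).ne'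
  have h2 : Continuous fun x : ℝ => Real.log (ν + x ^ 2) :=
    (by fun_prop : Continuous fun x : ℝ => ν + x ^ 2).log fun x => by positivity
  fun_prop

/-- A bound for the relative change of `quadT` from `θ` to `θ'`, uniform in `x`. -/
noncomputable def quadTGap (ν : ℝ) (θ θ' : ℝ × ℝ) : ℝ :=
  |θ.1 - θ'.1| * (1 + 1 / (ν * θ.2 ^ 2)) + (θ.1 - θ'.1) ^ 2 / (ν * θ.2 ^ 2) +
    |θ'.2 ^ 2 - θ.2 ^ 2| / θ.2 ^ 2

theorem quadTGap_nonneg {ν : ℝ} (hν : 0 < ν) (θ θ' : ℝ × ℝ) : 0 ≤ quadTGap ν θ θ' := by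
  unfold quadTGap; positivity

/-- The difference of the two quadratics is only affine in `x`, and `quadT` at θ dominates both `(x
- μ)²` and `νσ²`, so each term of the difference is a multiple of it. -/
theorem quadT_le {ν : ℝ} (hν : 0 < ν) (x : ℝ) {θ θ' : ℝ × ℝ} (hθ : 0 < θ.2) :
    quadT ν x θ' ≤ quadT ν x θ * (1 + quadTGap ν θ θ') := by
  obtain ⟨m, s⟩ := θ
  obtain ⟨m', s'⟩ := θ'
  simp only at hθ
  have hs : 0 < ν * s ^ 2 := by positivity
  have hD : ν * s ^ 2 ≤ quadT ν x (m, s) := by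
    simp only [quadT]; nlinarith [sq_nonneg (x - m)]
  have hD0 : 0 < quadT ν x (m, s) := hs.trans_le hD
  have e1 : 2 * (x - m) * (m - m') ≤ quadT ν x (m, s) * (|m - m'| * (1 + 1 / (ν * s ^ 2))) := by
    have h1 : (x - m) ^ 2 + 1 ≤ quadT ν x (m, s) * (1 + 1 / (ν * s ^ 2)) := by
      have : 1 ≤ quadT ν x (m, s) * (1 / (ν * s ^ 2)) := by
        rw [mul_one_div, le_div_iff₀ hs]; linarith
      have h3 : (x - m) ^ 2 ≤ quadT ν x (m, s) := by simp only [quadT]; linarith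
      linarith
    have h2 : 2 * (x - m) * (m - m') ≤ |m - m'| * ((x - m) ^ 2 + 1) := by
      rcases abs_cases (m - m') with ⟨h, _⟩ | ⟨h, _⟩ <;> rw [h] <;>
        nlinarith [sq_nonneg (x - m - 1), sq_nonneg (x - m + 1)]
    calc _ ≤ _ := h2
      _ ≤ |m - m'| * (quadT ν x (m, s) * (1 + 1 / (ν * s ^ 2))) := by gcongr
      _ = _ := by ring
  have e2 : (m - m') ^ 2 ≤ quadT ν x (m, s) * ((m - m') ^ 2 / (ν * s ^ 2)) := by
    rw [mul_div_assoc', le_div_iff₀ hs]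
    nlinarith [sq_nonneg (m - m')]
  have e3 : ν * (s' ^ 2 - s ^ 2) ≤ quadT ν x (m, s) * (|s' ^ 2 - s ^ 2| / s ^ 2) := by
    rw [mul_div_assoc', le_div_iff₀ (by positivity)]
    calc ν * (s' ^ 2 - s ^ 2) * s ^ 2 = ν * s ^ 2 * (s' ^ 2 - s ^ 2) := by ring
      _ ≤ ν * s ^ 2 * |s' ^ 2 - s ^ 2| := by gcongr; exact le_abs_self _
      _ ≤ _ := by gcongr
  have e4 : quadT ν x (m', s') = quadT ν x (m, s) + 2 * (x - m) * (m - m') + (m - m') ^ 2 +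
      ν * (s' ^ 2 - s ^ 2) := by simp only [quadT]; ring
  rw [e4]
  simp only [quadTGap, mul_add, mul_one] at *
  linarith

/-- A bound for the variation of `hT ν x` between two parameters, uniform in `x`. -/
noncomputable def hTGap (ν : ℝ) (θ θ' : ℝ × ℝ) : ℝ :=
  ν * |Real.log θ'.2 - Real.log θ.2| + (ν + 1) / 2 * (quadTGap ν θ θ' + quadTGap ν θ' θ)

/-- The bound does not involve `x`. It therefore serves every law at once: integrability, continuity
in θ, and continuity under simultaneous changes of law and parameter all rest on it. -/
theorem abs_hT_sub_le {ν : ℝ} (hν : 0 < ν) (x : ℝ) {θ θ' : ℝ × ℝ} (hθ : 0 < θ.2)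
    (hθ' : 0 < θ'.2) : |hT ν x θ' - hT ν x θ| ≤ hTGap ν θ θ' := by
  have key : ∀ {a b : ℝ × ℝ}, 0 < a.2 → 0 < b.2 →
      Real.log (quadT ν x b) - Real.log (quadT ν x a) ≤ quadTGap ν a b := by
    intro a b ha hb
    have h1 := Real.log_le_log (quadT_pos hν x hb) (quadT_le hν x (θ' := b) ha)
    have h0 := quadTGap_nonneg hν a b
    rw [Real.log_mul (quadT_pos hν x ha).ne' (by linarith)] at h1
    have h2 := Real.log_le_sub_one_of_pos (show 0 < 1 + quadTGap ν a b by linarith)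
    linarith
  have k1 := key hθ hθ'
  have k2 := key hθ' hθ
  have n1 := quadTGap_nonneg hν θ θ'
  have n2 := quadTGap_nonneg hν θ' θ
  rw [hT_eq hν x hθ, hT_eq hν x hθ', hTGap]
  have e : (-ν * Real.log θ'.2 + (ν + 1) / 2 * (Real.log (quadT ν x θ') - Real.log (ν + x ^ 2)) -
      (-ν * Real.log θ.2 + (ν + 1) / 2 * (Real.log (quadT ν x θ) - Real.log (ν + x ^ 2)))) =
      ν * (-(Real.log θ'.2 - Real.log θ.2)) +
      (ν + 1) / 2 * (Real.log (quadT ν x θ') - Real.log (quadT ν x θ)) := by ring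
  rw [e]
  refine (abs_add_le _ _).trans ?_
  rw [abs_mul, abs_mul, abs_neg, abs_of_pos hν, abs_of_pos (by linarith : 0 < (ν + 1) / 2)]
  gcongr
  exact abs_le.2 ⟨by linarith, by linarith⟩

theorem tendsto_hTGap {ν : ℝ} (hν : 0 < ν) {θ : ℝ × ℝ} (hθ : 0 < θ.2) :
    Tendsto (fun θ' => hTGap ν θ θ') (𝓝 θ) (𝓝 0) := by
  have h0 : hTGap ν θ θ = 0 := by simp [hTGap, quadTGap]
  have : ContinuousAt (fun θ' => hTGap ν θ θ') θ := by
    unfold hTGap quadTGap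
    have h1 : θ.2 ≠ 0 := hθ.ne'
    have h2 : ν * θ.2 ^ 2 ≠ 0 := by positivity
    have h3 : θ.2 ^ 2 ≠ 0 := by positivity
    fun_prop (disch := assumption)
  simpa [ContinuousAt, h0] using this

theorem abs_hT_le {ν : ℝ} (hν : 0 < ν) (x : ℝ) {θ : ℝ × ℝ} (hθ : 0 < θ.2) :
    |hT ν x θ| ≤ hTGap ν (0, 1) θ := by
  simpa [hT_base hν] using abs_hT_sub_le hν x (θ := (0, 1)) (by norm_num) hθ

theorem integrable_hT {ν : ℝ} (hν : 0 < ν) {θ : ℝ × ℝ} (hθ : 0 < θ.2)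
    (Q : ProbabilityMeasure ℝ) : Integrable (fun x => hT ν x θ) (Q : Measure ℝ) :=
  Integrable.of_bound (continuous_hT hν hθ).aestronglyMeasurable _
    (ae_of_all _ fun x => abs_hT_le hν x hθ)

theorem abs_meanHT_sub_le {ν : ℝ} (hν : 0 < ν) (Q : ProbabilityMeasure ℝ) {θ θ' : ℝ × ℝ}
    (hθ : 0 < θ.2) (hθ' : 0 < θ'.2) :
    |meanHT ν (Q : Measure ℝ) θ' - meanHT ν (Q : Measure ℝ) θ| ≤ hTGap ν θ θ' := by
  unfold meanHT
  rw [← integral_sub (integrable_hT hν hθ' Q) (integrable_hT hν hθ Q)]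
  simpa using norm_integral_le_of_norm_le_const (μ := (Q : Measure ℝ))
    (f := fun x => hT ν x θ' - hT ν x θ) (ae_of_all _ fun x => abs_hT_sub_le hν x hθ hθ')

/-- For fixed θ the integrand is bounded and continuous, so weak convergence applies; moving the
parameter costs at most `hTGap`, whatever the law. -/
theorem tendsto_meanHT {ν : ℝ} (hν : 0 < ν) {ι : Type*} {l : Filter ι}
    {Qs : ι → ProbabilityMeasure ℝ} {Q : ProbabilityMeasure ℝ} (hQ : Tendsto Qs l (𝓝 Q))
    {φ : ι → ℝ × ℝ} {θ : ℝ × ℝ} (hθ : 0 < θ.2) (hφ : Tendsto φ l (𝓝 θ)) :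
    Tendsto (fun i => meanHT ν (Qs i : Measure ℝ) (φ i)) l (𝓝 (meanHT ν (Q : Measure ℝ) θ)) := by
  let f : BoundedContinuousFunction ℝ ℝ :=
    BoundedContinuousFunction.ofNormedAddCommGroup (fun x => hT ν x θ) (continuous_hT hν hθ) _
      (fun x => abs_hT_le hν x hθ)
  have h1 : Tendsto (fun i => meanHT ν (Qs i : Measure ℝ) θ) l
      (𝓝 (meanHT ν (Q : Measure ℝ) θ)) :=
    ProbabilityMeasure.tendsto_iff_forall_integral_tendsto.1 hQ f
  have hpos : ∀ᶠ i in l, 0 < (φ i).2 :=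
    hφ.eventually ((isOpen_lt continuous_const continuous_snd).mem_nhds hθ)
  have h2 : Tendsto (fun i => meanHT ν (Qs i : Measure ℝ) (φ i) - meanHT ν (Qs i : Measure ℝ) θ) l
      (𝓝 0) :=
    squeeze_zero_norm' (hpos.mono fun i hi => abs_meanHT_sub_le hν (Qs i) hθ hi)
      ((tendsto_hTGap hν hθ).comp hφ)
  simpa using h2.add h1

/-! ### The gradient of `Q h_ν` and its critical points -/

/-- `∫ (x - μ) / ((x - μ)² + ν σ²) dQ(x)`; up to a factor the derivative of `Q h_ν` in `μ`. -/
noncomputable def locScore (ν : ℝ) (Q : Measure ℝ) (θ : ℝ × ℝ) : ℝ :=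
  ∫ x, (x - θ.1) / quadT ν x θ ∂Q

/-- `∫ 1 / ((x - μ)² + ν σ²) dQ(x)`, which determines the derivative of `Q h_ν` in `σ`. -/
noncomputable def invScore (ν : ℝ) (Q : Measure ℝ) (θ : ℝ × ℝ) : ℝ :=
  ∫ x, 1 / quadT ν x θ ∂Q

theorem inv_quadT_le {ν : ℝ} (hν : 0 < ν) (x : ℝ) {θ : ℝ × ℝ} (hθ : 0 < θ.2) :
    |1 / quadT ν x θ| ≤ 1 / (ν * θ.2 ^ 2) := by
  rw [abs_of_pos (one_div_pos.2 (quadT_pos hν x hθ))]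
  refine one_div_le_one_div_of_le (by positivity) ?_
  unfold quadT; nlinarith [sq_nonneg (x - θ.1)]

theorem loc_quadT_le {ν : ℝ} (hν : 0 < ν) (x : ℝ) {θ : ℝ × ℝ} (hθ : 0 < θ.2) :
    |(x - θ.1) / quadT ν x θ| ≤ 1 + 1 / (ν * θ.2 ^ 2) := by
  have hD := quadT_pos hν x hθ
  have hs : 0 < ν * θ.2 ^ 2 := by positivity
  rw [abs_div, abs_of_pos hD, div_le_iff₀ hD]
  have h1 : 1 ≤ 1 / (ν * θ.2 ^ 2) * quadT ν x θ := by
    rw [one_div_mul_eq_div, le_div_iff₀ hs]; unfold quadT; nlinarith [sq_nonneg (x - θ.1)]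
  have h2 : (x - θ.1) ^ 2 ≤ quadT ν x θ := by unfold quadT; linarith
  have h3 : |x - θ.1| ≤ (x - θ.1) ^ 2 + 1 := by
    rw [← sq_abs]; nlinarith [sq_nonneg (|x - θ.1| - 1), abs_nonneg (x - θ.1)]
  linarith

theorem integrable_inv_quadT {ν : ℝ} (hν : 0 < ν) {θ : ℝ × ℝ} (hθ : 0 < θ.2)
    (Q : ProbabilityMeasure ℝ) : Integrable (fun x => 1 / quadT ν x θ) (Q : Measure ℝ) :=
  Integrable.of_bound (continuous_const.div (continuous_quadT ν θ)
      fun x => (quadT_pos hν x hθ).ne').aestronglyMeasurable _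
    (ae_of_all _ fun x => inv_quadT_le hν x hθ)

theorem integrable_loc_quadT {ν : ℝ} (hν : 0 < ν) {θ : ℝ × ℝ} (hθ : 0 < θ.2)
    (Q : ProbabilityMeasure ℝ) :
    Integrable (fun x => (x - θ.1) / quadT ν x θ) (Q : Measure ℝ) :=
  Integrable.of_bound ((continuous_id.sub continuous_const).div (continuous_quadT ν θ)
      fun x => (quadT_pos hν x hθ).ne').aestronglyMeasurable _
    (ae_of_all _ fun x => loc_quadT_le hν x hθ)

/-- Differentiation under the integral sign for functions of two real parameters whose partial
derivatives `a` and `b` are locally bounded. -/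
theorem hasFDerivAt_integral_pair (Q : ProbabilityMeasure ℝ) {f a b : ℝ → ℝ × ℝ → ℝ} {θ : ℝ × ℝ}
    {s : Set (ℝ × ℝ)} (hs : s ∈ 𝓝 θ) {A B : ℝ}
    (hf : ∀ η ∈ s, Integrable (fun x => f x η) (Q : Measure ℝ))
    (ha : Continuous fun x => a x θ) (hb : Continuous fun x => b x θ)
    (hder : ∀ x, ∀ η ∈ s, HasFDerivAt (f x)
      (a x η • ContinuousLinearMap.fst ℝ ℝ ℝ + b x η • ContinuousLinearMap.snd ℝ ℝ ℝ) η)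
    (hA : ∀ x, ∀ η ∈ s, |a x η| ≤ A) (hB : ∀ x, ∀ η ∈ s, |b x η| ≤ B) :
    HasFDerivAt (fun η => ∫ x, f x η ∂(Q : Measure ℝ))
      ((∫ x, a x θ ∂(Q : Measure ℝ)) • ContinuousLinearMap.fst ℝ ℝ ℝ +
        (∫ x, b x θ ∂(Q : Measure ℝ)) • ContinuousLinearMap.snd ℝ ℝ ℝ) θ := by
  have hθ := mem_of_mem_nhds hs
  have ia : Integrable (fun x => a x θ) (Q : Measure ℝ) :=
    Integrable.of_bound ha.aestronglyMeasurable A (ae_of_all _ fun x => hA x θ hθ)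
  have ib : Integrable (fun x => b x θ) (Q : Measure ℝ) :=
    Integrable.of_bound hb.aestronglyMeasurable B (ae_of_all _ fun x => hB x θ hθ)
  have ja := ia.smul_const (ContinuousLinearMap.fst ℝ ℝ ℝ)
  have jb := ib.smul_const (ContinuousLinearMap.snd ℝ ℝ ℝ)
  have main := hasFDerivAt_integral_of_dominated_of_fderiv_le (μ := (Q : Measure ℝ))
    (F := fun η x => f x η) (x₀ := θ) (bound := fun _ => A * 1 + B * 1)
    (F' := fun η x => a x η • ContinuousLinearMap.fst ℝ ℝ ℝ +
      b x η • ContinuousLinearMap.snd ℝ ℝ ℝ) hs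
    (by filter_upwards [hs] with η hη using (hf η hη).aestronglyMeasurable) (hf θ hθ)
    (ja.add jb).aestronglyMeasurable
    (ae_of_all _ fun x η hη => by
      refine (norm_add_le _ _).trans (add_le_add ?_ ?_) <;> rw [norm_smul, Real.norm_eq_abs]
      · exact mul_le_mul (hA x η hη) (ContinuousLinearMap.norm_fst_le ℝ ℝ ℝ) (norm_nonneg _)
          ((abs_nonneg _).trans (hA x η hη))
      · exact mul_le_mul (hB x η hη) (ContinuousLinearMap.norm_snd_le ℝ ℝ ℝ) (norm_nonneg _)
          ((abs_nonneg _).trans (hB x η hη)))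
    (integrable_const _) (ae_of_all _ fun x η hη => hder x η hη)
  rwa [integral_add ja jb, integral_smul_const, integral_smul_const] at main

/-- A neighborhood of `θ` on which the scale stays away from `0` and `∞`. -/
theorem scale_mem_nhds {θ : ℝ × ℝ} (hθ : 0 < θ.2) :
    {η : ℝ × ℝ | θ.2 / 2 < η.2 ∧ η.2 < 2 * θ.2} ∈ 𝓝 θ :=
  ((isOpen_lt continuous_const continuous_snd).inter
    (isOpen_lt continuous_snd continuous_const)).mem_nhds ⟨by simp; linarith, by simp; linarith⟩

theorem continuous_inv_quadT {ν : ℝ} (hν : 0 < ν) {θ : ℝ × ℝ} (hθ : 0 < θ.2) :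
    Continuous fun x => 1 / quadT ν x θ :=
  continuous_const.div (continuous_quadT ν θ) fun x => (quadT_pos hν x hθ).ne'

theorem continuous_loc_quadT {ν : ℝ} (hν : 0 < ν) {θ : ℝ × ℝ} (hθ : 0 < θ.2) :
    Continuous fun x => (x - θ.1) / quadT ν x θ :=
  (continuous_id.sub continuous_const).div (continuous_quadT ν θ) fun x => (quadT_pos hν x hθ).ne'

theorem hasFDerivAt_quadT (ν x : ℝ) (θ : ℝ × ℝ) :
    HasFDerivAt (quadT ν x) ((-2 * (x - θ.1)) • ContinuousLinearMap.fst ℝ ℝ ℝ +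
      (2 * ν * θ.2) • ContinuousLinearMap.snd ℝ ℝ ℝ) θ := by
  have h1 : HasFDerivAt (fun θ : ℝ × ℝ => x - θ.1) (-ContinuousLinearMap.fst ℝ ℝ ℝ) θ :=
    (hasFDerivAt_fst (p := θ)).const_sub x
  have h2 : HasFDerivAt (fun θ : ℝ × ℝ => θ.2) (ContinuousLinearMap.snd ℝ ℝ ℝ) θ :=
    hasFDerivAt_snd (p := θ)
  have := (h1.pow 2).add ((h2.pow 2).const_mul ν)
  refine this.congr_fderiv ?_
  ext
  · simp
  · simp; ring

theorem hasFDerivAt_hT {ν : ℝ} (hν : 0 < ν) (x : ℝ) {θ : ℝ × ℝ} (hθ : 0 < θ.2) :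
    HasFDerivAt (hT ν x)
      ((-(ν + 1) * ((x - θ.1) / quadT ν x θ)) • ContinuousLinearMap.fst ℝ ℝ ℝ +
        (-ν / θ.2 + (ν + 1) * ν * θ.2 * (1 / quadT ν x θ)) •
          ContinuousLinearMap.snd ℝ ℝ ℝ) θ := by
  have h2 : HasFDerivAt (fun θ : ℝ × ℝ => θ.2) (ContinuousLinearMap.snd ℝ ℝ ℝ) θ :=
    hasFDerivAt_snd (p := θ)
  have hD := quadT_pos hν x hθ
  have h3 := ((h2.log hθ.ne').const_mul (-ν)).add
    ((((hasFDerivAt_quadT ν x θ).log hD.ne').sub_const (Real.log (ν + x ^ 2))).const_mul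
      ((ν + 1) / 2))
  have h4 : HasFDerivAt (hT ν x) _ θ := h3.congr_of_eventuallyEq (by
    filter_upwards [(isOpen_lt continuous_const continuous_snd).mem_nhds hθ] with y hy
    exact hT_eq hν x hy)
  refine h4.congr_fderiv ?_
  ext <;> (simp; field_simp; try ring)

theorem hasFDerivAt_meanHT {ν : ℝ} (hν : 0 < ν) (Q : ProbabilityMeasure ℝ) {θ : ℝ × ℝ}
    (hθ : 0 < θ.2) :
    HasFDerivAt (meanHT ν (Q : Measure ℝ))
      ((-(ν + 1) * locScore ν (Q : Measure ℝ) θ) • ContinuousLinearMap.fst ℝ ℝ ℝ +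
        (-ν / θ.2 + (ν + 1) * ν * θ.2 * invScore ν (Q : Measure ℝ) θ) •
          ContinuousLinearMap.snd ℝ ℝ ℝ) θ := by
  have main := hasFDerivAt_integral_pair Q (f := fun x η => hT ν x η)
    (a := fun x η => -(ν + 1) * ((x - η.1) / quadT ν x η))
    (b := fun x η => -ν / η.2 + (ν + 1) * ν * η.2 * (1 / quadT ν x η))
    (A := (ν + 1) * (1 + 1 / (ν * (θ.2 / 2) ^ 2)))
    (B := ν / (θ.2 / 2) + (ν + 1) * ν * (2 * θ.2) * (1 / (ν * (θ.2 / 2) ^ 2)))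
    (scale_mem_nhds hθ) (fun η hη => integrable_hT hν (by linarith [hη.1]) Q)
    (continuous_const.mul (continuous_loc_quadT hν hθ))
    (continuous_const.add (continuous_const.mul (continuous_inv_quadT hν hθ)))
    (fun x η hη => hasFDerivAt_hT hν x (by linarith [hη.1])) ?_ ?_
  · refine main.congr_fderiv ?_
    have i2 := (integrable_inv_quadT hν hθ Q).const_mul ((ν + 1) * ν * θ.2)
    rw [integral_const_mul, integral_add (integrable_const _) i2, integral_const_mul]
    simp [locScore, invScore]
  · intro x η hη
    have hη0 : 0 < η.2 := by linarith [hη.1]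
    have h1 := hη.1.le
    rw [abs_mul, abs_neg, abs_of_pos (by linarith : 0 < ν + 1)]
    calc _ ≤ (ν + 1) * (1 + 1 / (ν * η.2 ^ 2)) := by gcongr; exact loc_quadT_le hν x hη0
      _ ≤ _ := by gcongr
  · intro x η hη
    have hη0 : 0 < η.2 := by linarith [hη.1]
    have h1 := hη.1.le
    have h2 := hη.2.le
    refine (abs_add_le _ _).trans ?_
    rw [abs_div, abs_neg, abs_of_pos hν, abs_of_pos hη0, abs_mul,
      abs_of_pos (by positivity : 0 < (ν + 1) * ν * η.2)]
    calc _ ≤ ν / η.2 + (ν + 1) * ν * η.2 * (1 / (ν * η.2 ^ 2)) := by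
          gcongr; exact inv_quadT_le hν x hη0
      _ ≤ _ := by gcongr

/-- The equations for a critical point of `Q h_ν`. -/
def IsCriticalT (ν : ℝ) (Q : Measure ℝ) (θ : ℝ × ℝ) : Prop :=
  locScore ν Q θ = 0 ∧ (ν + 1) * θ.2 ^ 2 * invScore ν Q θ = 1

theorem hasDerivAt_meanHT_loc {ν : ℝ} (hν : 0 < ν) (Q : ProbabilityMeasure ℝ) {μ σ : ℝ}
    (hσ : 0 < σ) : HasDerivAt (fun m => meanHT ν (Q : Measure ℝ) (m, σ))
      (-(ν + 1) * locScore ν (Q : Measure ℝ) (μ, σ)) μ := by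
  have h := (hasFDerivAt_meanHT hν Q (θ := (μ, σ)) hσ).comp_hasDerivAt μ
    ((hasDerivAt_id μ).prodMk (hasDerivAt_const μ σ))
  simpa using! h

theorem hasDerivAt_meanHT_scale {ν : ℝ} (hν : 0 < ν) (Q : ProbabilityMeasure ℝ) {μ σ : ℝ}
    (hσ : 0 < σ) : HasDerivAt (fun s => meanHT ν (Q : Measure ℝ) (μ, s))
      (-ν / σ + (ν + 1) * ν * σ * invScore ν (Q : Measure ℝ) (μ, σ)) σ := by
  have h := (hasFDerivAt_meanHT hν Q (θ := (μ, σ)) hσ).comp_hasDerivAt σ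
    ((hasDerivAt_const σ μ).prodMk (hasDerivAt_id σ))
  simpa using! h

theorem scale_deriv_eq_zero_iff {ν σ e : ℝ} (hν : 0 < ν) (hσ : 0 < σ) :
    -ν / σ + (ν + 1) * ν * σ * e = 0 ↔ (ν + 1) * σ ^ 2 * e = 1 := by
  have : -ν / σ + (ν + 1) * ν * σ * e = ν / σ * ((ν + 1) * σ ^ 2 * e - 1) := by
    field_simp; ring
  rw [this, mul_eq_zero, sub_eq_zero]
  have : ν / σ ≠ 0 := by positivity
  tauto

theorem isCriticalT_of_hasDerivAt {ν : ℝ} (hν : 0 < ν) (Q : ProbabilityMeasure ℝ) {μ σ : ℝ}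
    (hσ : 0 < σ) (h1 : HasDerivAt (fun m => meanHT ν (Q : Measure ℝ) (m, σ)) 0 μ)
    (h2 : HasDerivAt (fun s => meanHT ν (Q : Measure ℝ) (μ, s)) 0 σ) :
    IsCriticalT ν (Q : Measure ℝ) (μ, σ) := by
  refine ⟨?_, (scale_deriv_eq_zero_iff hν hσ).1
    ((hasDerivAt_meanHT_scale hν Q hσ).unique h2)⟩
  have := (hasDerivAt_meanHT_loc hν Q hσ).unique h1
  rcases mul_eq_zero.1 this with h | h
  · linarith
  · exact h

theorem IsCriticalT.hasFDerivAt {ν : ℝ} (hν : 0 < ν) {Q : ProbabilityMeasure ℝ} {θ : ℝ × ℝ}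
    (hθ : 0 < θ.2) (h : IsCriticalT ν (Q : Measure ℝ) θ) :
    HasFDerivAt (meanHT ν (Q : Measure ℝ)) (0 : ℝ × ℝ →L[ℝ] ℝ) θ := by
  refine (hasFDerivAt_meanHT hν Q hθ).congr_fderiv ?_
  rw [h.1, (scale_deriv_eq_zero_iff hν hθ).2 h.2]
  simp

theorem isCriticalT_of_isMin {ν : ℝ} (hν : 0 < ν) (Q : ProbabilityMeasure ℝ) {θ : ℝ × ℝ}
    (hθ : 0 < θ.2)
    (hmin : ∀ φ : ℝ × ℝ, 0 < φ.2 → meanHT ν (Q : Measure ℝ) θ ≤ meanHT ν (Q : Measure ℝ) φ) :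
    IsCriticalT ν (Q : Measure ℝ) θ := by
  have hloc : IsLocalMin (meanHT ν (Q : Measure ℝ)) θ := by
    filter_upwards [(isOpen_lt continuous_const continuous_snd).mem_nhds hθ] with φ hφ
    exact hmin φ hφ
  have h0 := hloc.hasFDerivAt_eq_zero (hasFDerivAt_meanHT hν Q hθ)
  have h : HasFDerivAt (meanHT ν (Q : Measure ℝ)) (0 : ℝ × ℝ →L[ℝ] ℝ) θ :=
    (hasFDerivAt_meanHT hν Q hθ).congr_fderiv h0
  have d1 := h.comp_hasDerivAt θ.1 ((hasDerivAt_id θ.1).prodMk (hasDerivAt_const θ.1 θ.2))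
  have d2 := h.comp_hasDerivAt θ.2 ((hasDerivAt_const θ.2 θ.1).prodMk (hasDerivAt_id θ.2))
  exact isCriticalT_of_hasDerivAt hν Q hθ (by simpa using! d1) (by simpa using! d2)

/-! ### Convexity along hyperbolic geodesics -/

/-- The derivative is monotone: after clearing denominators the comparison reduces to `AB e^(s-t) ≤
AB e^(t-s)` for `s ≤ t`. -/
theorem convexOn_log_add_exp {A B : ℝ} (hA : 0 ≤ A) (hB : 0 ≤ B) (hAB : 0 < A + B) :
    ConvexOn ℝ Set.univ fun t => Real.log (A * Real.exp t + B * Real.exp (-t)) := by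
  have hpos : ∀ t : ℝ, 0 < A * Real.exp t + B * Real.exp (-t) := fun t => by
    rcases hA.eq_or_lt with rfl | h
    · have : 0 < B := by linarith
      positivity
    · positivity
  have hd : ∀ t : ℝ, HasDerivAt (fun t => Real.log (A * Real.exp t + B * Real.exp (-t)))
      ((A * Real.exp t - B * Real.exp (-t)) / (A * Real.exp t + B * Real.exp (-t))) t := fun t => by
    have h1 := (((Real.hasDerivAt_exp t).const_mul A).add
      (((hasDerivAt_neg t).exp).const_mul B)).log (hpos t).ne'
    refine h1.congr_deriv ?_
    simp only [Pi.add_apply]; ring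
  refine MonotoneOn.convexOn_of_deriv convex_univ
    (fun t _ => (hd t).continuousAt.continuousWithinAt)
    (fun t _ => (hd t).differentiableAt.differentiableWithinAt) ?_
  intro s _ t _ hst
  rw [(hd s).deriv, (hd t).deriv, div_le_div_iff₀ (hpos s) (hpos t)]
  have e1 : Real.exp s * Real.exp (-t) ≤ Real.exp t * Real.exp (-s) := by
    rw [← Real.exp_add, ← Real.exp_add]; exact Real.exp_le_exp.2 (by linarith)
  nlinarith [mul_le_mul_of_nonneg_left e1 (mul_nonneg hA hB)]

theorem strictConvexOn_log_cosh : StrictConvexOn ℝ Set.univ fun t => Real.log (Real.cosh t) := by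
  have hd : ∀ t : ℝ, HasDerivAt (fun t => Real.log (Real.cosh t)) (Real.sinh t / Real.cosh t) t :=
    fun t => (Real.hasDerivAt_cosh t).log (Real.cosh_pos t).ne'
  refine StrictMonoOn.strictConvexOn_of_deriv convex_univ
    (fun t _ => (hd t).continuousAt.continuousWithinAt) ?_
  intro s _ t _ hst
  rw [(hd s).deriv, (hd t).deriv, div_lt_div_iff₀ (Real.cosh_pos s) (Real.cosh_pos t)]
  have := Real.sinh_pos_iff.2 (sub_pos.2 hst)
  rw [Real.sinh_sub] at this
  linarith

theorem convexOn_integral {Q : Measure ℝ} {f : ℝ → ℝ → ℝ}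
    (hf : ∀ x, ConvexOn ℝ Set.univ fun t => f x t) (hint : ∀ t, Integrable (fun x => f x t) Q) :
    ConvexOn ℝ Set.univ fun t => ∫ x, f x t ∂Q := by
  refine ⟨convex_univ, fun s _ t _ a b ha hb hab => ?_⟩
  simp only [smul_eq_mul]
  rw [← integral_const_mul, ← integral_const_mul,
    ← integral_add ((hint s).const_mul a) ((hint t).const_mul b)]
  exact integral_mono (hint _) (((hint s).const_mul a).add ((hint t).const_mul b))
    fun x => (hf x).2 trivial trivial ha hb hab

/-- The half-circle with center `c` and radius `r` in the coordinates `(μ, √ν σ)`. -/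
noncomputable def halfCircle (ν c r t : ℝ) : ℝ × ℝ :=
  (c + r * (Real.sinh t / Real.cosh t), r / (Real.sqrt ν * Real.cosh t))

theorem halfCircle_pos {ν r : ℝ} (hν : 0 < ν) (c : ℝ) (hr : 0 < r) (t : ℝ) :
    0 < (halfCircle ν c r t).2 := by
  have := Real.cosh_pos t
  simp only [halfCircle]; positivity

theorem quadT_halfCircle {ν : ℝ} (hν : 0 < ν) (c r t x : ℝ) :
    quadT ν x (halfCircle ν c r t) =
      ((x - c - r) ^ 2 / 2 * Real.exp t + (x - c + r) ^ 2 / 2 * Real.exp (-t)) / Real.cosh t := by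
  have hc := Real.cosh_pos t
  have h1 := Real.cosh_sq t
  have e1 : Real.exp t = Real.cosh t + Real.sinh t := (Real.cosh_add_sinh t).symm
  have e2 : Real.exp (-t) = Real.cosh t - Real.sinh t := (Real.cosh_sub_sinh t).symm
  have h2 : ν * (r / (Real.sqrt ν * Real.cosh t)) ^ 2 = r ^ 2 / Real.cosh t ^ 2 := by
    rw [div_pow, mul_pow, Real.sq_sqrt hν.le]; field_simp
  simp only [quadT, halfCircle]
  rw [h2, e1, e2]
  field_simp
  linear_combination -2 * r ^ 2 * h1

/-- The coefficient of `log cosh` collects `ν` from `-ν log σ` and `-(ν+1)/2` from the denominator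
of `quadT`. Its positivity is what requires `ν > 1`. -/
theorem hT_halfCircle {ν r : ℝ} (hν : 0 < ν) (c : ℝ) (hr : 0 < r) (t x : ℝ) :
    hT ν x (halfCircle ν c r t) =
      ((ν + 1) / 2 * Real.log ((x - c - r) ^ 2 / 2 * Real.exp t +
        (x - c + r) ^ 2 / 2 * Real.exp (-t)) +
      (-ν * (Real.log r - Real.log (Real.sqrt ν)) - (ν + 1) / 2 * Real.log (ν + x ^ 2))) +
      (ν - 1) / 2 * Real.log (Real.cosh t) := by
  have hc := Real.cosh_pos t
  have hs := Real.sqrt_pos.2 hν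
  have hD := quadT_pos hν x (halfCircle_pos hν c hr t)
  rw [hT_eq hν x (halfCircle_pos hν c hr t)]
  rw [quadT_halfCircle hν] at hD ⊢
  have hN : 0 < (x - c - r) ^ 2 / 2 * Real.exp t + (x - c + r) ^ 2 / 2 * Real.exp (-t) := by
    rwa [lt_div_iff₀ hc, zero_mul] at hD
  rw [Real.log_div hN.ne' hc.ne']
  simp only [halfCircle]
  rw [Real.log_div hr.ne' (by positivity), Real.log_mul hs.ne' hc.ne']
  ring

theorem strictConvexOn_meanHT_halfCircle {ν r : ℝ} (hν : 1 < ν) (Q : ProbabilityMeasure ℝ) (c : ℝ)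
    (hr : 0 < r) :
    StrictConvexOn ℝ Set.univ fun t => meanHT ν (Q : Measure ℝ) (halfCircle ν c r t) := by
  have hν0 : 0 < ν := by linarith
  have hint : ∀ t, Integrable (fun x => hT ν x (halfCircle ν c r t) -
      (ν - 1) / 2 * Real.log (Real.cosh t)) (Q : Measure ℝ) := fun t =>
    (integrable_hT hν0 (halfCircle_pos hν0 c hr t) Q).sub (integrable_const _)
  have h1 : ConvexOn ℝ Set.univ fun t => ∫ x, (hT ν x (halfCircle ν c r t) -
      (ν - 1) / 2 * Real.log (Real.cosh t)) ∂(Q : Measure ℝ) := by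
    refine convexOn_integral (fun x => ?_) hint
    have : (fun t => hT ν x (halfCircle ν c r t) - (ν - 1) / 2 * Real.log (Real.cosh t)) =
        fun t => ((ν + 1) / 2) • Real.log ((x - c - r) ^ 2 / 2 * Real.exp t +
          (x - c + r) ^ 2 / 2 * Real.exp (-t)) +
        (-ν * (Real.log r - Real.log (Real.sqrt ν)) - (ν + 1) / 2 * Real.log (ν + x ^ 2)) := by
      funext t; rw [hT_halfCircle hν0 c hr, add_sub_cancel_right, smul_eq_mul]
    rw [this]
    refine ((convexOn_log_add_exp (by positivity) (by positivity) ?_).smul (by linarith)).add_const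
      _
    nlinarith [sq_nonneg (x - c)]
  have h2 : StrictConvexOn ℝ Set.univ fun t => (ν - 1) / 2 * Real.log (Real.cosh t) := by
    refine ⟨convex_univ, fun s hs t ht hst a b ha hb hab => ?_⟩
    have := strictConvexOn_log_cosh.2 hs ht hst ha hb hab
    simp only [smul_eq_mul] at this ⊢
    nlinarith [mul_lt_mul_of_pos_left this (by linarith : 0 < (ν - 1) / 2)]
  have h3 := h1.add_strictConvexOn h2
  refine h3.congr fun t _ => ?_
  simp only [Pi.add_apply]
  rw [integral_sub (integrable_hT hν0 (halfCircle_pos hν0 c hr t) Q) (integrable_const _)]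
  simp [meanHT]

/-- On a vertical line the remainder is linear in `t`, so strictness can only come from the
logarithm, which is itself affine when `x = μ`. -/
theorem hT_vertical {ν : ℝ} (hν : 0 < ν) (μ t x : ℝ) :
    hT ν x (μ, Real.exp t) = (ν + 1) / 2 * Real.log (ν * Real.exp t +
      (x - μ) ^ 2 * Real.exp (-t)) + ((1 - ν) / 2 * t - (ν + 1) / 2 * Real.log (ν + x ^ 2)) := by
  have hE := Real.exp_pos t
  rw [hT_eq hν x hE]
  have : quadT ν x (μ, Real.exp t) =
      (ν * Real.exp t + (x - μ) ^ 2 * Real.exp (-t)) * Real.exp t := by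
    simp only [quadT, Real.exp_neg]; field_simp; ring
  rw [this, Real.log_mul (by positivity) hE.ne', Real.log_exp]
  ring

theorem convexOn_meanHT_vertical {ν : ℝ} (hν : 0 < ν) (Q : ProbabilityMeasure ℝ) (μ : ℝ) :
    ConvexOn ℝ Set.univ fun t => meanHT ν (Q : Measure ℝ) (μ, Real.exp t) := by
  refine convexOn_integral (fun x => ?_) fun t => integrable_hT hν (Real.exp_pos t) Q
  have : (fun t => hT ν x (μ, Real.exp t)) =
      fun t => ((ν + 1) / 2) • Real.log (ν * Real.exp t + (x - μ) ^ 2 * Real.exp (-t)) +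
      ((1 - ν) / 2 * t - (ν + 1) / 2 * Real.log (ν + x ^ 2)) := by
    funext t; rw [hT_vertical hν, smul_eq_mul]
  rw [this]
  refine ((convexOn_log_add_exp hν.le (sq_nonneg _) (by positivity)).smul (by linarith)).add ?_
  refine ⟨convex_univ, fun s _ t _ a b _ _ hab => le_of_eq ?_⟩
  simp only [smul_eq_mul]
  linear_combination (ν + 1) / 2 * Real.log (ν + x ^ 2) * hab

/-- A point of the half-circle, given by its equation. -/
theorem exists_halfCircle_eq {ν c r : ℝ} (hν : 0 < ν) (hr : 0 < r) {θ : ℝ × ℝ} (hθ : 0 < θ.2)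
    (h : (θ.1 - c) ^ 2 + ν * θ.2 ^ 2 = r ^ 2) :
    halfCircle ν c r (Real.arsinh ((θ.1 - c) / (Real.sqrt ν * θ.2))) = θ := by
  have hs := Real.sqrt_pos.2 hν
  have h1 : Real.cosh (Real.arsinh ((θ.1 - c) / (Real.sqrt ν * θ.2))) = r / (Real.sqrt ν * θ.2) := by
    rw [Real.cosh_arsinh]
    have : 1 + ((θ.1 - c) / (Real.sqrt ν * θ.2)) ^ 2 = (r / (Real.sqrt ν * θ.2)) ^ 2 := by
      rw [div_pow, div_pow, mul_pow, Real.sq_sqrt hν.le, ← h]; field_simp; ring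
    rw [this, Real.sqrt_sq (by positivity)]
  unfold halfCircle
  rw [h1, Real.sinh_arsinh]
  ext
  · simp only; field_simp; ring
  · simp only; field_simp

/-- The half-circle through two points with different first coordinates. -/
theorem exists_halfCircle_through {ν : ℝ} (hν : 0 < ν) {θ φ : ℝ × ℝ} (hθ : 0 < θ.2)
    (hne : θ.1 ≠ φ.1) :
    ∃ c r : ℝ, 0 < r ∧ (θ.1 - c) ^ 2 + ν * θ.2 ^ 2 = r ^ 2 ∧
      (φ.1 - c) ^ 2 + ν * φ.2 ^ 2 = r ^ 2 := by
  have hd : φ.1 - θ.1 ≠ 0 := sub_ne_zero.2 hne.symm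
  refine ⟨((φ.1 ^ 2 + ν * φ.2 ^ 2) - (θ.1 ^ 2 + ν * θ.2 ^ 2)) / (2 * (φ.1 - θ.1)), _,
    Real.sqrt_pos.2 (?_ : 0 < (θ.1 - ((φ.1 ^ 2 + ν * φ.2 ^ 2) - (θ.1 ^ 2 + ν * θ.2 ^ 2)) /
      (2 * (φ.1 - θ.1))) ^ 2 + ν * θ.2 ^ 2), ?_, ?_⟩
  · positivity
  · rw [Real.sq_sqrt (by positivity)]
  · rw [Real.sq_sqrt (by positivity)]
    field_simp
    ring

/-- The point of the geodesic between two parameters at which `quadT` is the convex combination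
with weight `w`. -/
noncomputable def geoPoint (ν w : ℝ) (θ φ : ℝ × ℝ) : ℝ × ℝ :=
  ((1 - w) * θ.1 + w * φ.1,
    Real.sqrt ((1 - w) * θ.2 ^ 2 + w * φ.2 ^ 2 + w * (1 - w) * (θ.1 - φ.1) ^ 2 / ν))

theorem geoPoint_pos {ν w : ℝ} (hν : 0 < ν) (hw0 : 0 ≤ w) (hw1 : w < 1) {θ : ℝ × ℝ} (φ : ℝ × ℝ)
    (hθ : 0 < θ.2) : 0 < (geoPoint ν w θ φ).2 := by
  have : 0 < 1 - w := by linarith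
  exact Real.sqrt_pos.2 (by positivity)

/-- This is geodesic quasi-convexity in a form that avoids geodesic parameters: `geoPoint` is
explicit in `w`, so its limit can be computed even when φ approaches the boundary or infinity. -/
theorem meanHT_geoPoint_le {ν w : ℝ} (hν : 1 < ν) (Q : ProbabilityMeasure ℝ) (hw0 : 0 ≤ w)
    (hw1 : w < 1) {θ φ : ℝ × ℝ} (hθ : 0 < θ.2) (hφ : 0 < φ.2) :
    meanHT ν (Q : Measure ℝ) (geoPoint ν w θ φ) ≤
      max (meanHT ν (Q : Measure ℝ) θ) (meanHT ν (Q : Measure ℝ) φ) := by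
  have hν0 : 0 < ν := by linarith
  have hg := geoPoint_pos hν0 hw0 hw1 φ hθ
  have hw2 : 0 < 1 - w := by linarith
  have hgsq : (geoPoint ν w θ φ).2 ^ 2 =
      (1 - w) * θ.2 ^ 2 + w * φ.2 ^ 2 + w * (1 - w) * (θ.1 - φ.1) ^ 2 / ν :=
    Real.sq_sqrt (by positivity)
  by_cases hne : θ.1 = φ.1
  · have hg1 : (geoPoint ν w θ φ).1 = θ.1 := by simp only [geoPoint, hne]; ring
    rw [hne, sub_self, zero_pow two_ne_zero, mul_zero, zero_div, add_zero] at hgsq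
    have hmem : ∀ {a : ℝ × ℝ}, 0 < a.2 → a.1 = θ.1 → (θ.1, Real.exp (Real.log a.2)) = a := by
      intro a ha h; rw [Real.exp_log ha, ← h]
    have hseg : Real.log (geoPoint ν w θ φ).2 ∈ segment ℝ (Real.log θ.2) (Real.log φ.2) := by
      rw [segment_eq_uIcc]
      rcases le_total θ.2 φ.2 with h | h
      · rw [Set.uIcc_of_le (Real.log_le_log hθ h)]
        constructor <;> refine Real.log_le_log (by assumption) ?_ <;>
          refine (pow_le_pow_iff_left₀ (by linarith) (by linarith) two_ne_zero).1 ?_ <;> rw [hgsq] <;>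
          nlinarith [pow_le_pow_left₀ hθ.le h 2]
      · rw [Set.uIcc_of_ge (Real.log_le_log hφ h)]
        constructor <;> refine Real.log_le_log (by assumption) ?_ <;>
          refine (pow_le_pow_iff_left₀ (by linarith) (by linarith) two_ne_zero).1 ?_ <;> rw [hgsq] <;>
          nlinarith [pow_le_pow_left₀ hφ.le h 2]
    have := (convexOn_meanHT_vertical hν0 Q θ.1).le_max_of_mem_segment trivial trivial hseg
    rwa [hmem hg hg1, hmem hθ rfl, hmem hφ hne.symm] at this
  · obtain ⟨c, r, hr, h1, h2⟩ := exists_halfCircle_through hν0 hθ hne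
    -- The equation of the half-circle says that `quadT` at `x = c` equals `r²`, and `geoPoint`
    -- averages `quadT`.
    have h3 : ((geoPoint ν w θ φ).1 - c) ^ 2 + ν * (geoPoint ν w θ φ).2 ^ 2 = r ^ 2 := by
      rw [hgsq]
      simp only [geoPoint]
      field_simp
      linear_combination (1 - w) * h1 + w * h2
    have e1 := exists_halfCircle_eq hν0 hr hθ h1
    have e2 := exists_halfCircle_eq hν0 hr hφ h2
    have e3 := exists_halfCircle_eq hν0 hr hg h3
    set t1 := Real.arsinh ((θ.1 - c) / (Real.sqrt ν * θ.2))
    set t2 := Real.arsinh ((φ.1 - c) / (Real.sqrt ν * φ.2))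
    set t3 := Real.arsinh (((geoPoint ν w θ φ).1 - c) / (Real.sqrt ν * (geoPoint ν w θ φ).2))
    -- The first coordinate increases along the arc, so betweenness of the arc parameters can be
    -- read off from the first coordinates.
    have hmono : StrictMono fun t => (halfCircle ν c r t).1 := by
      intro s t hst
      simp only [halfCircle]
      have : Real.sinh s / Real.cosh s < Real.sinh t / Real.cosh t := by
        rw [div_lt_div_iff₀ (Real.cosh_pos s) (Real.cosh_pos t)]
        have := Real.sinh_pos_iff.2 (sub_pos.2 hst)
        rw [Real.sinh_sub] at this
        linarith
      nlinarith
    have hseg : t3 ∈ segment ℝ t1 t2 := by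
      have key : ∀ s t : ℝ, (halfCircle ν c r s).1 ≤ (halfCircle ν c r t).1 → s ≤ t :=
        fun s t h => hmono.le_iff_le.1 h
      have hg1 : (geoPoint ν w θ φ).1 = (1 - w) * θ.1 + w * φ.1 := rfl
      rw [segment_eq_uIcc]
      rcases le_total θ.1 φ.1 with h | h
      · rw [Set.uIcc_of_le (key _ _ (by rw [e1, e2]; exact h))]
        constructor <;> apply key <;> simp only [e1, e2, e3, hg1] <;> nlinarith
      · rw [Set.uIcc_of_ge (key _ _ (by rw [e1, e2]; exact h))]
        constructor <;> apply key <;> simp only [e1, e2, e3, hg1] <;> nlinarith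
    have := (strictConvexOn_meanHT_halfCircle hν Q c hr).convexOn.le_max_of_mem_segment
      trivial trivial hseg
    rwa [e1, e2, e3] at this

/-! ### Uniqueness of the critical point -/

theorem StrictConvexOn.hasDerivAt_zero_unique {f : ℝ → ℝ} (hf : StrictConvexOn ℝ Set.univ f)
    {s t : ℝ} (hs : HasDerivAt f 0 s) (ht : HasDerivAt f 0 t) : s = t := by
  have hmin : ∀ {u : ℝ}, HasDerivAt f 0 u → IsMinOn f Set.univ u := fun {u} hu =>
    hf.convexOn.isMinOn_of_rightDeriv_eq_zero (by simp)
      (hu.hasDerivWithinAt.derivWithin (uniqueDiffWithinAt_Ioi u))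
  exact hf.eq_of_isMinOn (hmin hs) (hmin ht) trivial trivial

theorem differentiableAt_halfCircle {ν : ℝ} (hν : 0 < ν) (c r t : ℝ) :
    DifferentiableAt ℝ (halfCircle ν c r) t := by
  have h1 : Real.cosh t ≠ 0 := (Real.cosh_pos t).ne'
  have h2 : Real.sqrt ν * Real.cosh t ≠ 0 := mul_ne_zero (Real.sqrt_pos.2 hν).ne' h1
  unfold halfCircle
  fun_prop (disch := assumption)

/-- Two critical points with different locations lie on a common half-circle, contrary to strict
convexity. With equal locations the scale equation decides: `σ² / quadT` is strictly increasing in σ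
except at `x = μ`, so two solutions would force `Q` to be the point mass at μ. -/
theorem IsCriticalT.eq {ν : ℝ} (hν : 1 < ν) {Q : ProbabilityMeasure ℝ}
    (hQ : ∀ t : ℝ, (Q : Measure ℝ).real {t} < 1) {θ φ : ℝ × ℝ} (hθ : 0 < θ.2) (hφ : 0 < φ.2)
    (h1 : IsCriticalT ν (Q : Measure ℝ) θ) (h2 : IsCriticalT ν (Q : Measure ℝ) φ) : θ = φ := by
  have hν0 : 0 < ν := by linarith
  by_cases hne : θ.1 = φ.1
  · wlog hle : θ.2 ≤ φ.2 generalizing θ φ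
    · exact (this hφ hθ h2 h1 hne.symm (le_of_not_ge hle)).symm
    by_contra hcon
    have hlt : θ.2 < φ.2 := lt_of_le_of_ne hle fun h => hcon (Prod.ext hne h)
    have iθ := (integrable_inv_quadT hν0 hθ Q).const_mul (θ.2 ^ 2)
    have iφ := (integrable_inv_quadT hν0 hφ Q).const_mul (φ.2 ^ 2)
    have hdiff : ∀ x, φ.2 ^ 2 * (1 / quadT ν x φ) - θ.2 ^ 2 * (1 / quadT ν x θ) =
        (φ.2 ^ 2 - θ.2 ^ 2) * (x - θ.1) ^ 2 / (quadT ν x φ * quadT ν x θ) := by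
      intro x
      have := (quadT_pos hν0 x hθ).ne'
      have := (quadT_pos hν0 x hφ).ne'
      field_simp
      simp only [quadT, ← hne]; ring
    have hsq : 0 < φ.2 ^ 2 - θ.2 ^ 2 := by nlinarith
    have h0 : ∫ x, (φ.2 ^ 2 * (1 / quadT ν x φ) - θ.2 ^ 2 * (1 / quadT ν x θ)) ∂(Q : Measure ℝ) =
        0 := by
      rw [integral_sub iφ iθ, integral_const_mul, integral_const_mul]
      have e1 := h1.2
      have e2 := h2.2
      simp only [invScore] at e1 e2
      have : 0 < ν + 1 := by linarith
      have : (ν + 1) * (φ.2 ^ 2 * ∫ x, 1 / quadT ν x φ ∂(Q : Measure ℝ) -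
        θ.2 ^ 2 * ∫ x, 1 / quadT ν x θ ∂(Q : Measure ℝ)) = 0 := by linarith
      simpa [this, (by linarith : ν + 1 ≠ 0)] using this
    replace h0 := (integral_eq_zero_iff_of_nonneg (fun x => by
      have p1 := quadT_pos hν0 x hθ
      have p2 := quadT_pos hν0 x hφ
      have : 0 ≤ (φ.2 ^ 2 - θ.2 ^ 2) * (x - θ.1) ^ 2 / (quadT ν x φ * quadT ν x θ) := by
        positivity
      exact this.trans_eq (hdiff x).symm) (iφ.sub iθ)).1 h0
    have h3 : ∀ᵐ x ∂(Q : Measure ℝ), x ∈ ({θ.1} : Set ℝ) := by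
      filter_upwards [h0] with x hx
      replace hx := (hdiff x).symm.trans hx
      have p1 := (quadT_pos hν0 x hθ).ne'
      have p2 := (quadT_pos hν0 x hφ).ne'
      rw [Pi.zero_apply, div_eq_zero_iff] at hx
      have : (x - θ.1) ^ 2 = 0 := by
        rcases hx with h | h
        · exact (mul_eq_zero.1 h).resolve_left hsq.ne'
        · exact absurd h (mul_ne_zero p2 p1)
      simpa [sub_eq_zero] using this
    have h4 := hQ θ.1
    rw [measureReal_def, (mem_ae_iff_prob_eq_one (measurableSet_singleton _)).1 h3] at h4
    simp at h4
  · obtain ⟨c, r, hr, k1, k2⟩ := exists_halfCircle_through hν0 hθ hne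
    have e1 := exists_halfCircle_eq hν0 hr hθ k1
    have e2 := exists_halfCircle_eq hν0 hr hφ k2
    have hder : ∀ t, IsCriticalT ν (Q : Measure ℝ) (halfCircle ν c r t) →
        HasDerivAt (fun t => meanHT ν (Q : Measure ℝ) (halfCircle ν c r t)) 0 t := by
      intro t ht
      have := (ht.hasFDerivAt hν0 (halfCircle_pos hν0 c hr t)).comp_hasDerivAt t
        (differentiableAt_halfCircle hν0 c r t).hasDerivAt
      simpa using! this
    have := (strictConvexOn_meanHT_halfCircle hν Q c hr).hasDerivAt_zero_unique
      (hder _ (by rw [e1]; exact h1)) (hder _ (by rw [e2]; exact h2))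
    rw [← e1, ← e2, this]

/-! ### Large atoms -/

theorem measureReal_singleton_mul_le_integral {Q : Measure ℝ} [IsFiniteMeasure Q] {f : ℝ → ℝ}
    (hf : ∀ x, 0 ≤ f x) (hint : Integrable f Q) (s : ℝ) : Q.real {s} * f s ≤ ∫ x, f x ∂Q := by
  have h1 : ∫ x, ({s} : Set ℝ).indicator (fun _ => f s) x ∂Q = Q.real {s} * f s := by
    rw [integral_indicator_const _ (measurableSet_singleton s), smul_eq_mul]
  rw [← h1]
  refine integral_mono ((integrable_const _).indicator (measurableSet_singleton s)) hint fun x => ?_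
  by_cases hx : x = s
  · subst hx; simp
  · simp [hx, hf x]

theorem div_add_one_lt_one {ν : ℝ} (hν : 1 < ν) : ν / (ν + 1) < 1 := by
  rw [div_lt_one (by linarith)]; linarith

theorem half_lt_div_add_one {ν : ℝ} (hν : 1 < ν) : 1 / 2 < ν / (ν + 1) := by
  rw [div_lt_div_iff₀ (by norm_num) (by linarith)]; linarith

/-- Write `τ = νσ²`, `a = s - μ`, `p = ν/(ν+1)`. At a critical point the integral of `(τ + (x-μ)a)²
/ quadT` is `a² + (τ - a²)p`, while the atom alone contributes at least `p(τ + a²)`. Since `p > 1/2`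
this forces `a = 0`. Then `τ / quadT`, whose integral is `p`, dominates the indicator of `s`,
strictly off `s`; so all mass sits at `s`, although `p < 1`. -/
theorem not_isCriticalT_of_atom {ν : ℝ} (hν : 1 < ν) (Q : ProbabilityMeasure ℝ) {s : ℝ}
    (hs : ν / (ν + 1) ≤ (Q : Measure ℝ).real {s}) {θ : ℝ × ℝ} (hθ : 0 < θ.2) :
    ¬ IsCriticalT ν (Q : Measure ℝ) θ := by
  rintro ⟨h1, h2⟩
  have hν0 : 0 < ν := by linarith
  have hp2 := half_lt_div_add_one hν
  have hp1 := div_add_one_lt_one hν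
  have hinv : ν * θ.2 ^ 2 * invScore ν (Q : Measure ℝ) θ = ν / (ν + 1) := by
    rw [eq_div_iff (by linarith)]; linear_combination ν * h2
  set p := ν / (ν + 1) with hp
  set τ := ν * θ.2 ^ 2 with hτ
  have hτ0 : 0 < τ := by positivity
  set a := s - θ.1 with ha
  have hD : ∀ x, quadT ν x θ = (x - θ.1) ^ 2 + τ := fun x => rfl
  have iinv := integrable_inv_quadT hν0 hθ Q
  have iloc := integrable_loc_quadT hν0 hθ Q
  have hexp : ∀ x, (τ + (x - θ.1) * a) ^ 2 / quadT ν x θ =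
      a ^ 2 + (τ * (τ - a ^ 2) * (1 / quadT ν x θ) +
        2 * τ * a * ((x - θ.1) / quadT ν x θ)) := by
    intro x
    have := (quadT_pos hν0 x hθ).ne'
    field_simp
    rw [hD]; ring
  have i12 : Integrable (fun x => τ * (τ - a ^ 2) * (1 / quadT ν x θ) +
        2 * τ * a * ((x - θ.1) / quadT ν x θ)) (Q : Measure ℝ) :=
    (iinv.const_mul _).add (iloc.const_mul _)
  have iall : Integrable (fun x => a ^ 2 + (τ * (τ - a ^ 2) * (1 / quadT ν x θ) +
        2 * τ * a * ((x - θ.1) / quadT ν x θ))) (Q : Measure ℝ) :=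
    (integrable_const _).add i12
  have hle := measureReal_singleton_mul_le_integral (Q := (Q : Measure ℝ))
    (f := fun x => (τ + (x - θ.1) * a) ^ 2 / quadT ν x θ)
    (fun x => div_nonneg (sq_nonneg _) (quadT_pos hν0 x hθ).le)
    (by simp_rw [hexp]; exact iall) s
  have hval : ∫ x, (τ + (x - θ.1) * a) ^ 2 / quadT ν x θ ∂(Q : Measure ℝ) =
      a ^ 2 + (τ - a ^ 2) * p := by
    simp_rw [hexp]
    rw [integral_add (integrable_const _) i12,
      integral_add (iinv.const_mul _) (iloc.const_mul _), integral_const_mul, integral_const_mul]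
    simp only [locScore] at h1
    simp only [invScore] at hinv
    rw [h1]
    simp only [integral_const, probReal_univ, smul_eq_mul]
    linear_combination (τ - a ^ 2) * hinv
  rw [hval] at hle
  -- The numerator was chosen so that at `x = s` it is the square of the denominator.
  have hs2 : (τ + (s - θ.1) * a) ^ 2 / quadT ν s θ = τ + a ^ 2 := by
    have : quadT ν s θ = τ + a ^ 2 := by rw [hD, ← ha]; ring
    rw [this, ← ha, div_eq_iff (by positivity)]; ring
  simp only [hs2] at hle
  have ha0 : a = 0 := by
    have : p * (τ + a ^ 2) ≤ a ^ 2 + (τ - a ^ 2) * p :=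
      (mul_le_mul_of_nonneg_right hs (by positivity)).trans hle
    by_contra hne
    have : 0 < a ^ 2 := by positivity
    nlinarith
  have hsθ : s = θ.1 := sub_eq_zero.1 ha0
  have hτe : ∫ x, τ * (1 / quadT ν x θ) ∂(Q : Measure ℝ) = p := by
    rw [integral_const_mul]; exact hinv
  have hI : Integrable (({s} : Set ℝ).indicator fun _ : ℝ => (1 : ℝ)) (Q : Measure ℝ) :=
    (integrable_const _).indicator (measurableSet_singleton s)
  have hIe : ∫ x, ({s} : Set ℝ).indicator (fun _ : ℝ => (1 : ℝ)) x ∂(Q : Measure ℝ) =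
      (Q : Measure ℝ).real {s} := by
    rw [integral_indicator_const _ (measurableSet_singleton s), smul_eq_mul, mul_one]
  have hpt : ∀ x, x ≠ s → 0 < τ * (1 / quadT ν x θ) -
      ({s} : Set ℝ).indicator (fun _ : ℝ => (1 : ℝ)) x := by
    intro x hx
    have := quadT_pos hν0 x hθ
    simp [hx]; positivity
  have hpt0 : τ * (1 / quadT ν s θ) - ({s} : Set ℝ).indicator (fun _ : ℝ => (1 : ℝ)) s = 0 := by
    have : quadT ν s θ = τ := by rw [hD, hsθ]; ring
    simp [this, hτ0.ne']
  have hnn : ∀ x, 0 ≤ τ * (1 / quadT ν x θ) -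
      ({s} : Set ℝ).indicator (fun _ : ℝ => (1 : ℝ)) x := by
    intro x
    by_cases hx : x = s
    · rw [hx]; exact hpt0.ge
    · exact (hpt x hx).le
  have hint := integral_sub (iinv.const_mul τ) hI
  have hge : 0 ≤ ∫ x, (τ * (1 / quadT ν x θ) -
      ({s} : Set ℝ).indicator (fun _ : ℝ => (1 : ℝ)) x) ∂(Q : Measure ℝ) := integral_nonneg hnn
  rw [hτe, hIe] at hint
  have h0 : ∫ x, (τ * (1 / quadT ν x θ) -
      ({s} : Set ℝ).indicator (fun _ : ℝ => (1 : ℝ)) x) ∂(Q : Measure ℝ) = 0 := by linarith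
  have hae := (integral_eq_zero_iff_of_nonneg hnn ((iinv.const_mul τ).sub hI)).1 h0
  have h3 : ∀ᵐ x ∂(Q : Measure ℝ), x ∈ ({s} : Set ℝ) := by
    filter_upwards [hae] with x hx
    by_contra hne
    exact (hpt x hne).ne' hx
  have h4 : (Q : Measure ℝ).real {s} = 1 := by
    rw [measureReal_def, (mem_ae_iff_prob_eq_one (measurableSet_singleton _)).1 h3]; simp
  linarith

theorem eq_of_large_atoms {ν : ℝ} (hν : 1 < ν) (Q : ProbabilityMeasure ℝ) {s t : ℝ}
    (hs : ν / (ν + 1) ≤ (Q : Measure ℝ).real {s})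
    (ht : ν / (ν + 1) ≤ (Q : Measure ℝ).real {t}) : s = t := by
  by_contra hne
  have h1 := measureReal_union (μ := (Q : Measure ℝ)) (s₁ := {s}) (s₂ := {t})
    (by simpa using hne) (measurableSet_singleton t)
  have h2 : (Q : Measure ℝ).real ({s} ∪ {t}) ≤ 1 := measureReal_le_one
  have := half_lt_div_add_one hν
  linarith

/-! ### Limits of approximate minimizers -/

/-- The integrand `νσ² / quadT` lies in `[0, 1]` and tends to the indicator of `{b}`; dominated
convergence detects the atom at `b`. -/
theorem tendsto_scale_invScore_zero {ν : ℝ} (hν : 0 < ν) (Q : ProbabilityMeasure ℝ) (b : ℝ) :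
    Tendsto (fun σ => ν * σ ^ 2 * invScore ν (Q : Measure ℝ) (b, σ)) (𝓝[>] 0)
      (𝓝 ((Q : Measure ℝ).real {b})) := by
  have hIe : ∫ x, ({b} : Set ℝ).indicator (fun _ : ℝ => (1 : ℝ)) x ∂(Q : Measure ℝ) =
      (Q : Measure ℝ).real {b} := by
    rw [integral_indicator_const _ (measurableSet_singleton b), smul_eq_mul, mul_one]
  simp only [invScore, ← integral_const_mul]
  rw [← hIe]
  refine tendsto_integral_filter_of_dominated_convergence (fun _ => 1) ?_ ?_
    (integrable_const _) (ae_of_all _ fun x => ?_)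
  · filter_upwards [self_mem_nhdsWithin] with σ hσ
    exact ((integrable_inv_quadT hν (θ := (b, σ)) hσ Q).const_mul _).aestronglyMeasurable
  · filter_upwards [self_mem_nhdsWithin] with σ hσ
    have hσ' : 0 < σ := hσ
    refine ae_of_all _ fun x => ?_
    rw [Real.norm_eq_abs, abs_mul, abs_of_pos (by positivity : 0 < ν * σ ^ 2)]
    have := inv_quadT_le hν x (θ := (b, σ)) hσ
    calc _ ≤ ν * σ ^ 2 * (1 / (ν * σ ^ 2)) := by gcongr
      _ = 1 := by field_simp
  · by_cases hx : x = b
    · subst hx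
      refine Tendsto.congr' ?_ tendsto_const_nhds
      filter_upwards [self_mem_nhdsWithin] with σ hσ
      have hσ' : 0 < σ := hσ
      simp only [quadT, sub_self, Set.mem_singleton_iff, Set.indicator_of_mem]
      field_simp
      simp
    · have hne : (x - b) ^ 2 ≠ 0 := pow_ne_zero _ (sub_ne_zero.2 hx)
      have : ContinuousAt (fun σ : ℝ => ν * σ ^ 2 * (1 / ((x - b) ^ 2 + ν * σ ^ 2))) 0 := by
        have : (x - b) ^ 2 + ν * (0 : ℝ) ^ 2 ≠ 0 := by simpa using hne
        fun_prop (disch := assumption)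
      have h := this.tendsto.mono_left (nhdsWithin_le_nhds (s := Set.Ioi 0))
      simpa [quadT, hx] using h

theorem tendsto_scale_invScore_atTop {ν : ℝ} (hν : 0 < ν) (Q : ProbabilityMeasure ℝ) (b : ℝ) :
    Tendsto (fun σ => ν * σ ^ 2 * invScore ν (Q : Measure ℝ) (b, σ)) atTop (𝓝 1) := by
  have hIe : ∫ _x : ℝ, (1 : ℝ) ∂(Q : Measure ℝ) = 1 := by simp
  simp only [invScore, ← integral_const_mul]
  convert_to Tendsto _ _ (𝓝 (∫ _x : ℝ, (1 : ℝ) ∂(Q : Measure ℝ)))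
  · rw [hIe]
  refine tendsto_integral_filter_of_dominated_convergence (fun _ => 1) ?_ ?_
    (integrable_const _) (ae_of_all _ fun x => ?_)
  · filter_upwards [eventually_gt_atTop 0] with σ hσ
    exact ((integrable_inv_quadT hν (θ := (b, σ)) hσ Q).const_mul _).aestronglyMeasurable
  · filter_upwards [eventually_gt_atTop 0] with σ hσ
    refine ae_of_all _ fun x => ?_
    rw [Real.norm_eq_abs, abs_mul, abs_of_pos (by positivity : 0 < ν * σ ^ 2)]
    have := inv_quadT_le hν x (θ := (b, σ)) hσ
    calc _ ≤ ν * σ ^ 2 * (1 / (ν * σ ^ 2)) := by gcongr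
      _ = 1 := by field_simp
  · have h1 : Tendsto (fun σ : ℝ => ν * σ ^ 2) atTop atTop :=
      (tendsto_pow_atTop two_ne_zero).const_mul_atTop hν
    have h2 : Tendsto (fun σ : ℝ => 1 / ((x - b) ^ 2 / (ν * σ ^ 2) + 1)) atTop
        (𝓝 (1 / (0 + 1))) :=
      tendsto_const_nhds.div ((h1.const_div_atTop _).add_const 1) (by norm_num)
    rw [zero_add, div_one] at h2
    refine h2.congr' ?_
    filter_upwards [eventually_gt_atTop 0] with σ hσ
    simp only [quadT]
    field_simp

/-- Points on the geodesic from `p` to an approximate minimizer are asymptotically no worse than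
`p`. Only the limit of these intermediate points needs to lie in Θ, not the limit of `φ i`. -/
theorem tendsto_geoPoint_le {ν : ℝ} (hν : 1 < ν) {ι : Type*} {l : Filter ι} [l.NeBot]
    {Qs : ι → ProbabilityMeasure ℝ} {Q : ProbabilityMeasure ℝ} (hQ : Tendsto Qs l (𝓝 Q))
    {φ : ι → ℝ × ℝ} (hφ : ∀ᶠ i in l, 0 < (φ i).2) {p q : ℝ × ℝ} (hp : 0 < p.2) (hq : 0 < q.2)
    (hmin : ∀ ε > 0, ∀ᶠ i in l, meanHT ν (Qs i : Measure ℝ) (φ i) ≤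
      meanHT ν (Qs i : Measure ℝ) p + ε)
    {w : ι → ℝ} (hw : ∀ᶠ i in l, 0 ≤ w i ∧ w i < 1)
    (hlim : Tendsto (fun i => geoPoint ν (w i) p (φ i)) l (𝓝 q)) :
    meanHT ν (Q : Measure ℝ) q ≤ meanHT ν (Q : Measure ℝ) p := by
  have hν0 : 0 < ν := by linarith
  refine le_of_forall_pos_le_add fun ε hε => ?_
  refine le_of_tendsto_of_tendsto (tendsto_meanHT hν0 hQ hq hlim)
    ((tendsto_meanHT hν0 hQ hp tendsto_const_nhds).add_const ε) ?_
  filter_upwards [hφ, hmin ε hε, hw] with i h1 h2 h3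
  refine (meanHT_geoPoint_le hν (Qs i) h3.1 h3.2 hp h1).trans (max_le ?_ h2)
  linarith

theorem boundary_limit {ν : ℝ} (hν : 1 < ν) {ι : Type*} {l : Filter ι} [l.NeBot]
    {Qs : ι → ProbabilityMeasure ℝ} {Q : ProbabilityMeasure ℝ} (hQ : Tendsto Qs l (𝓝 Q))
    {φ : ι → ℝ × ℝ} (hφ : ∀ᶠ i in l, 0 < (φ i).2)
    (hmin : ∀ p : ℝ × ℝ, 0 < p.2 → ∀ ε > 0, ∀ᶠ i in l, meanHT ν (Qs i : Measure ℝ) (φ i) ≤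
      meanHT ν (Qs i : Measure ℝ) p + ε)
    {b : ℝ} (hb : Tendsto φ l (𝓝 (b, 0))) : ν / (ν + 1) ≤ (Q : Measure ℝ).real {b} := by
  have hν0 : 0 < ν := by linarith
  have hmono : MonotoneOn (fun s => meanHT ν (Q : Measure ℝ) (b, s)) (Set.Ioi 0) := by
    intro s hs t ht hst
    have hs0 : 0 < s := hs
    have ht0 : 0 < t := ht
    have hst1 : s / t ≤ 1 := (div_le_one ht0).2 hst
    refine tendsto_geoPoint_le hν hQ hφ (p := (b, t)) (q := (b, s)) ht hs (hmin _ ht)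
      -- With this weight the geodesic point between `(b, t)` and the boundary point `(b, 0)` has
      -- squared scale `(s/t)² t² = s²`.
      (w := fun _ => 1 - (s / t) ^ 2) (Eventually.of_forall fun _ => ⟨?_, ?_⟩) ?_
    · nlinarith [show 0 ≤ s / t by positivity]
    · have : 0 < (s / t) ^ 2 := by positivity
      linarith
    · have hc : Continuous fun y : ℝ × ℝ => geoPoint ν (1 - (s / t) ^ 2) (b, t) y := by
        unfold geoPoint; fun_prop
      have h := (hc.tendsto (b, 0)).comp hb
      have e : geoPoint ν (1 - (s / t) ^ 2) (b, t) (b, 0) = (b, s) := by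
        simp only [geoPoint]
        ext
        · simp only; ring
        · simp only
          have : (1 - (1 - (s / t) ^ 2)) * t ^ 2 + (1 - (s / t) ^ 2) * 0 ^ 2 +
              (1 - (s / t) ^ 2) * (1 - (1 - (s / t) ^ 2)) * (b - b) ^ 2 / ν = s ^ 2 := by
            field_simp; ring
          rw [this, Real.sqrt_sq hs0.le]
      rwa [e] at h
  have hder : ∀ σ : ℝ, 0 < σ →
      ν / (ν + 1) ≤ ν * σ ^ 2 * invScore ν (Q : Measure ℝ) (b, σ) := by
    intro σ hσ
    have h1 := (hmono.derivWithin_nonneg (x := σ))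
    rw [((hasDerivAt_meanHT_scale hν0 Q hσ).hasDerivWithinAt).derivWithin
      ((isOpen_Ioi.uniqueDiffOn) σ hσ)] at h1
    have h2 : -ν / σ + (ν + 1) * ν * σ * invScore ν (Q : Measure ℝ) (b, σ) =
      (ν + 1) / σ * (ν * σ ^ 2 * invScore ν (Q : Measure ℝ) (b, σ) - ν / (ν + 1)) := by
      have : ν + 1 ≠ 0 := by linarith
      field_simp; ring
    rw [h2] at h1
    have h3 := nonneg_of_mul_nonneg_right h1 (by positivity : 0 < (ν + 1) / σ)
    linarith
  -- The nonnegative σ-derivative bounds the scale integral below for every σ; the bound passes to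
  -- `σ → 0`.
  refine ge_of_tendsto (tendsto_scale_invScore_zero hν0 Q b) ?_
  filter_upwards [self_mem_nhdsWithin] with σ hσ
  exact hder σ hσ

theorem not_tendsto_infinity {ν : ℝ} (hν : 1 < ν) {ι : Type*} {l : Filter ι} [l.NeBot]
    {Qs : ι → ProbabilityMeasure ℝ} {Q : ProbabilityMeasure ℝ} (hQ : Tendsto Qs l (𝓝 Q))
    {φ : ι → ℝ × ℝ} (hφ : ∀ᶠ i in l, 0 < (φ i).2)
    (hmin : ∀ p : ℝ × ℝ, 0 < p.2 → ∀ ε > 0, ∀ᶠ i in l, meanHT ν (Qs i : Measure ℝ) (φ i) ≤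
      meanHT ν (Qs i : Measure ℝ) p + ε)
    (hinf : ∀ R : ℝ, ∀ᶠ i in l, R < ‖φ i‖) : False := by
  have hν0 : 0 < ν := by linarith
  set N : ι → ℝ := fun i => (φ i).1 ^ 2 + ν * (φ i).2 ^ 2 with hN
  have hNtop : Tendsto N l atTop := by
    refine tendsto_atTop.2 fun B => ?_
    filter_upwards [hinf (max B 1)] with i hi
    have h1 : ‖φ i‖ ^ 2 ≤ N i := by
      rw [Prod.norm_def]
      rcases max_cases ‖(φ i).1‖ ‖(φ i).2‖ with ⟨h, _⟩ | ⟨h, _⟩ <;>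
        rw [h, Real.norm_eq_abs, sq_abs] <;> simp only [hN] <;>
        nlinarith [sq_nonneg (φ i).1, sq_nonneg (φ i).2]
    have h2 := le_max_left B 1
    have h3 := le_max_right B 1
    nlinarith
  have hanti : AntitoneOn (fun s => meanHT ν (Q : Measure ℝ) (0, s)) (Set.Ioi 0) := by
    intro s hs t ht hst
    have hs0 : 0 < s := hs
    have ht0 : 0 < t := ht
    -- With weight `w = κ / N` the squared scale of the geodesic point from `(0, s)` is `(1-w)s² +
    -- κ/ν - (wμ)²/ν`, which tends to `s² + κ/ν = t²`; its location `wμ` tends to 0 because `(wμ)² ≤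
    -- κ²/N`.
    set κ := ν * (t ^ 2 - s ^ 2) with hκ
    have hκ0 : 0 ≤ κ := by
      have : s ^ 2 ≤ t ^ 2 := pow_le_pow_left₀ hs0.le hst 2
      exact mul_nonneg hν0.le (by linarith)
    have hw0 : Tendsto (fun i => κ / N i) l (𝓝 0) := hNtop.const_div_atTop κ
    have hNpos := hNtop.eventually_gt_atTop 0
    have hwm2 : Tendsto (fun i => (κ / N i * (φ i).1) ^ 2) l (𝓝 0) := by
      refine squeeze_zero' (Eventually.of_forall fun i => sq_nonneg _) ?_
        (hNtop.const_div_atTop (κ ^ 2))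
      filter_upwards [hNpos] with i hi
      have : (φ i).1 ^ 2 ≤ N i := by simp only [hN]; nlinarith [sq_nonneg (φ i).2]
      calc (κ / N i * (φ i).1) ^ 2 = κ ^ 2 / N i ^ 2 * (φ i).1 ^ 2 := by rw [mul_pow, div_pow]
        _ ≤ κ ^ 2 / N i ^ 2 * N i := by gcongr
        _ = κ ^ 2 / N i := by field_simp
    have hwm : Tendsto (fun i => κ / N i * (φ i).1) l (𝓝 0) := by
      have := hwm2.sqrt
      simp only [Real.sqrt_sq_eq_abs, Real.sqrt_zero] at this
      exact tendsto_zero_iff_abs_tendsto_zero _ |>.2 this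
    refine tendsto_geoPoint_le hν hQ hφ (p := (0, s)) (q := (0, t)) hs ht (hmin _ hs)
      (w := fun i => κ / N i) ?_ ?_
    · filter_upwards [hNpos, hw0.eventually (gt_mem_nhds one_pos)] with i h1 h2
      exact ⟨by positivity, h2⟩
    · refine Tendsto.prodMk_nhds ?_ ?_
      · simpa using hwm
      · have h1 : Tendsto (fun i => (1 - κ / N i) * s ^ 2 + (κ / ν - (κ / N i * (φ i).1) ^ 2 / ν)) l
            (𝓝 ((1 - 0) * s ^ 2 + (κ / ν - 0 / ν))) :=
          (((tendsto_const_nhds.sub hw0).mul_const _).add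
            (tendsto_const_nhds.sub (hwm2.div_const ν)))
        have e : (1 - 0) * s ^ 2 + (κ / ν - 0 / ν) = t ^ 2 := by
          rw [hκ]; field_simp; ring
        rw [e] at h1
        have h2 := h1.sqrt
        rw [Real.sqrt_sq ht0.le] at h2
        refine h2.congr' ?_
        filter_upwards [hNpos] with i hi
        congr 1
        have hκN : κ / ν = κ / N i * N i / ν := by field_simp
        rw [hκN]
        generalize κ / N i = w
        simp only [hN]
        field_simp
        ring
  have hder : ∀ σ : ℝ, 0 < σ →
      ν * σ ^ 2 * invScore ν (Q : Measure ℝ) (0, σ) ≤ ν / (ν + 1) := by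
    intro σ hσ
    have h1 := (hanti.derivWithin_nonpos (x := σ))
    rw [((hasDerivAt_meanHT_scale hν0 Q hσ).hasDerivWithinAt).derivWithin
      ((isOpen_Ioi.uniqueDiffOn) σ hσ)] at h1
    have h2 : -ν / σ + (ν + 1) * ν * σ * invScore ν (Q : Measure ℝ) (0, σ) =
      (ν + 1) / σ * (ν * σ ^ 2 * invScore ν (Q : Measure ℝ) (0, σ) - ν / (ν + 1)) := by
      have : ν + 1 ≠ 0 := by linarith
      field_simp; ring
    rw [h2] at h1
    have h3 := nonpos_of_mul_nonpos_right h1 (by positivity : 0 < (ν + 1) / σ)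
    linarith
  have := le_of_tendsto (tendsto_scale_invScore_atTop hν0 Q 0)
    ((eventually_gt_atTop 0).mono fun σ hσ => hder σ hσ)
  linarith [div_add_one_lt_one hν]

/-- An ultrafilter is either eventually bounded, hence convergent in the closed half-plane, or
leaves every ball. The filter form lets law and parameter vary together, and later covers existence,
separation and continuity. -/
theorem limit_of_approximate_minimizers {ν : ℝ} (hν : 1 < ν) {ι : Type*} (l : Ultrafilter ι)
    {Qs : ι → ProbabilityMeasure ℝ} {Q : ProbabilityMeasure ℝ} (hQ : Tendsto Qs l (𝓝 Q))
    {φ : ι → ℝ × ℝ} (hφ : ∀ᶠ i in (l : Filter ι), 0 < (φ i).2)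
    (hmin : ∀ p : ℝ × ℝ, 0 < p.2 → ∀ ε > 0, ∀ᶠ i in (l : Filter ι),
      meanHT ν (Qs i : Measure ℝ) (φ i) ≤ meanHT ν (Qs i : Measure ℝ) p + ε) :
    (∃ z : ℝ × ℝ, 0 < z.2 ∧ Tendsto φ l (𝓝 z) ∧
      ∀ p : ℝ × ℝ, 0 < p.2 → meanHT ν (Q : Measure ℝ) z ≤ meanHT ν (Q : Measure ℝ) p) ∨
    ∃ b : ℝ, Tendsto φ l (𝓝 (b, 0)) ∧ ν / (ν + 1) ≤ (Q : Measure ℝ).real {b} := by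
  have hν0 : 0 < ν := by linarith
  by_cases hbd : ∃ R : ℝ, ∀ᶠ i in (l : Filter ι), ‖φ i‖ ≤ R
  · obtain ⟨R, hR⟩ := hbd
    obtain ⟨z, -, hz⟩ := (isCompact_closedBall (0 : ℝ × ℝ) R).ultrafilter_le_nhds'
      (l.map φ) (Ultrafilter.mem_map.2 (hR.mono fun i hi => by simpa using hi))
    have hz' : Tendsto φ l (𝓝 z) := hz
    have hz2 : 0 ≤ z.2 := ge_of_tendsto ((continuous_snd.tendsto z).comp hz')
      (hφ.mono fun i hi => hi.le)
    rcases hz2.eq_or_lt with h0 | hpos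
    · right
      have e : z = (z.1, 0) := Prod.ext rfl h0.symm
      rw [e] at hz'
      exact ⟨z.1, hz', boundary_limit hν hQ hφ hmin hz'⟩
    · refine Or.inl ⟨z, hpos, hz', fun p hp => le_of_forall_pos_le_add fun ε hε => ?_⟩
      exact le_of_tendsto_of_tendsto (tendsto_meanHT hν0 hQ hpos hz')
        ((tendsto_meanHT hν0 hQ hp tendsto_const_nhds).add_const ε) (hmin p hp ε hε)
  · refine (not_tendsto_infinity hν hQ hφ hmin fun R => ?_).elim
    have : ¬ ∀ᶠ i in (l : Filter ι), ‖φ i‖ ≤ R := fun h => hbd ⟨R, h⟩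
    rw [← Ultrafilter.eventually_not] at this
    exact this.mono fun i hi => not_le.1 hi

/-! ### The extended M-functional -/

/-- The filter generated by the sets `{φ ∈ Θ | F φ < c}`, where `c` is larger than some value of
`F` on `Θ`: the filter of approximate minimizers of `F`. -/
def approxMin (F : ℝ × ℝ → ℝ) : Filter (ℝ × ℝ) :=
  ⨅ (c : ℝ) (_ : ∃ p : ℝ × ℝ, 0 < p.2 ∧ F p < c), 𝓟 {φ | 0 < φ.2 ∧ F φ < c}

theorem hasBasis_approxMin (F : ℝ × ℝ → ℝ) :
    (approxMin F).HasBasis (fun c => ∃ p : ℝ × ℝ, 0 < p.2 ∧ F p < c)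
      fun c => {φ | 0 < φ.2 ∧ F φ < c} := by
  refine hasBasis_biInf_principal' ?_ ⟨F (0, 1) + 1, (0, 1), by norm_num, by linarith⟩
  rintro c ⟨p, hp, hpc⟩ d ⟨q, hq, hqd⟩
  rcases le_total c d with h | h
  · exact ⟨c, ⟨p, hp, hpc⟩, subset_rfl, fun φ hφ => ⟨hφ.1, hφ.2.trans_le h⟩⟩
  · exact ⟨d, ⟨q, hq, hqd⟩, fun φ hφ => ⟨hφ.1, hφ.2.trans_le h⟩, subset_rfl⟩

instance (F : ℝ × ℝ → ℝ) : (approxMin F).NeBot :=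
  (hasBasis_approxMin F).neBot_iff.2 fun {_} hc => hc

theorem eventually_approxMin_pos (F : ℝ × ℝ → ℝ) : ∀ᶠ φ in approxMin F, 0 < φ.2 :=
  (hasBasis_approxMin F).eventually_iff.2
    ⟨F (0, 1) + 1, ⟨(0, 1), by norm_num, by linarith⟩, fun _ hφ => hφ.1⟩

theorem eventually_approxMin_le (F : ℝ × ℝ → ℝ) {p : ℝ × ℝ} (hp : 0 < p.2) {ε : ℝ} (hε : 0 < ε) :
    ∀ᶠ φ in approxMin F, F φ ≤ F p + ε :=
  (hasBasis_approxMin F).eventually_iff.2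
    ⟨F p + ε, ⟨p, hp, by linarith⟩, fun _ hφ => hφ.2.le⟩

open Classical in
/-- The extended M-functional: the large atom with scale `0` if there is one, and otherwise the
minimizer of `Q h_ν`. -/
noncomputable def thetaT (ν : ℝ) (Q : ProbabilityMeasure ℝ) : ℝ × ℝ :=
  if h : ∃ s : ℝ, ν / (ν + 1) ≤ (Q : Measure ℝ).real {s} then (h.choose, 0)
  -- The final value `(0, 0)` is never taken when `ν > 1`: by `exists_minimizer` a law without a
  -- large atom has a minimizer.
  else if h : ∃ z : ℝ × ℝ, 0 < z.2 ∧ ∀ p : ℝ × ℝ, 0 < p.2 →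
    meanHT ν (Q : Measure ℝ) z ≤ meanHT ν (Q : Measure ℝ) p then h.choose else (0, 0)

theorem thetaT_of_atom {ν : ℝ} (hν : 1 < ν) {Q : ProbabilityMeasure ℝ} {s : ℝ}
    (hs : ν / (ν + 1) ≤ (Q : Measure ℝ).real {s}) : thetaT ν Q = (s, 0) := by
  have h : ∃ s : ℝ, ν / (ν + 1) ≤ (Q : Measure ℝ).real {s} := ⟨s, hs⟩
  rw [thetaT, dif_pos h, eq_of_large_atoms hν Q h.choose_spec hs]

theorem exists_minimizer {ν : ℝ} (hν : 1 < ν) {Q : ProbabilityMeasure ℝ}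
    (hQ : Q ∈ smallAtomLaws ν) : ∃ z : ℝ × ℝ, 0 < z.2 ∧ ∀ p : ℝ × ℝ, 0 < p.2 →
      meanHT ν (Q : Measure ℝ) z ≤ meanHT ν (Q : Measure ℝ) p := by
  set F := meanHT ν (Q : Measure ℝ)
  have hle := Ultrafilter.of_le (approxMin F)
  rcases limit_of_approximate_minimizers hν (Ultrafilter.of (approxMin F))
    (Qs := fun _ => Q) (Q := Q) (φ := id) tendsto_const_nhds
    ((eventually_approxMin_pos F).filter_mono hle)
    (fun p hp ε hε => (eventually_approxMin_le F hp hε).filter_mono hle) with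
    ⟨z, hz, -, hmin⟩ | ⟨b, -, hb⟩
  · exact ⟨z, hz, hmin⟩
  · exact absurd hb (hQ b).not_ge

theorem thetaT_spec {ν : ℝ} (hν : 1 < ν) {Q : ProbabilityMeasure ℝ} (hQ : Q ∈ smallAtomLaws ν) :
    0 < (thetaT ν Q).2 ∧ ∀ p : ℝ × ℝ, 0 < p.2 →
      meanHT ν (Q : Measure ℝ) (thetaT ν Q) ≤ meanHT ν (Q : Measure ℝ) p := by
  have h1 : ¬ ∃ s : ℝ, ν / (ν + 1) ≤ (Q : Measure ℝ).real {s} := fun ⟨s, hs⟩ => (hQ s).not_ge hs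
  have h2 := exists_minimizer hν hQ
  rw [thetaT, dif_neg h1, dif_pos h2]
  exact h2.choose_spec

theorem lt_one_of_mem_smallAtomLaws {ν : ℝ} (hν : 1 < ν) {Q : ProbabilityMeasure ℝ}
    (hQ : Q ∈ smallAtomLaws ν) (t : ℝ) : (Q : Measure ℝ).real {t} < 1 :=
  (hQ t).trans (div_add_one_lt_one hν)

theorem isCriticalT_thetaT {ν : ℝ} (hν : 1 < ν) {Q : ProbabilityMeasure ℝ}
    (hQ : Q ∈ smallAtomLaws ν) : IsCriticalT ν (Q : Measure ℝ) (thetaT ν Q) :=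
  isCriticalT_of_isMin (by linarith) Q (thetaT_spec hν hQ).1 (thetaT_spec hν hQ).2

theorem eq_thetaT_of_isCriticalT {ν : ℝ} (hν : 1 < ν) {Q : ProbabilityMeasure ℝ}
    (hQ : Q ∈ smallAtomLaws ν) {θ : ℝ × ℝ} (hθ : 0 < θ.2)
    (h : IsCriticalT ν (Q : Measure ℝ) θ) : θ = thetaT ν Q :=
  h.eq hν (lt_one_of_mem_smallAtomLaws hν hQ) hθ (thetaT_spec hν hQ).1 (isCriticalT_thetaT hν hQ)

theorem meanHT_thetaT_lt {ν : ℝ} (hν : 1 < ν) {Q : ProbabilityMeasure ℝ}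
    (hQ : Q ∈ smallAtomLaws ν) {φ : ℝ × ℝ} (hφ : 0 < φ.2) (hne : φ ≠ thetaT ν Q) :
    meanHT ν (Q : Measure ℝ) (thetaT ν Q) < meanHT ν (Q : Measure ℝ) φ := by
  refine lt_of_not_ge fun hle => hne (eq_thetaT_of_isCriticalT hν hQ hφ ?_)
  exact isCriticalT_of_isMin (by linarith) Q hφ fun p hp => hle.trans ((thetaT_spec hν hQ).2 p hp)

theorem thetaT_mem_closure {ν : ℝ} (hν : 1 < ν) (Q : ProbabilityMeasure ℝ) :
    thetaT ν Q ∈ locScaleClosure := by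
  by_cases h : ∃ s : ℝ, ν / (ν + 1) ≤ (Q : Measure ℝ).real {s}
  · obtain ⟨s, hs⟩ := h
    rw [thetaT_of_atom hν hs]
    exact le_refl (0 : ℝ)
  · exact (thetaT_spec hν fun s => lt_of_not_ge fun hs => h ⟨s, hs⟩).1.le

/-- Approximate minimizers of `Q_i h_ν`, where `Q_i → Q` weakly, converge to the extended
M-functional of `Q`. -/
theorem tendsto_approximate_minimizers {ν : ℝ} (hν : 1 < ν) {ι : Type*} (l : Filter ι)
    {Qs : ι → ProbabilityMeasure ℝ} {Q : ProbabilityMeasure ℝ} (hQ : Tendsto Qs l (𝓝 Q))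
    {φ : ι → ℝ × ℝ} (hφ : ∀ᶠ i in l, 0 < (φ i).2)
    (hmin : ∀ p : ℝ × ℝ, 0 < p.2 → ∀ ε > 0, ∀ᶠ i in l,
      meanHT ν (Qs i : Measure ℝ) (φ i) ≤ meanHT ν (Qs i : Measure ℝ) p + ε) :
    Tendsto φ l (𝓝 (thetaT ν Q)) := by
  refine tendsto_iff_ultrafilter φ l _ |>.2 fun u hu => ?_
  rcases limit_of_approximate_minimizers hν u (hQ.mono_left hu) (hφ.filter_mono hu)
    (fun p hp ε hε => (hmin p hp ε hε).filter_mono hu) with ⟨z, hz, hlim, hzmin⟩ | ⟨b, hlim, hb⟩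
  -- An interior limit is a critical point, so there is no large atom and `thetaT` is this point;
  -- the alternatives match the cases of its definition.
  · have hcrit := isCriticalT_of_isMin (by linarith) Q hz hzmin
    have hsmall : Q ∈ smallAtomLaws ν := fun s =>
      lt_of_not_ge fun hs => not_isCriticalT_of_atom hν Q hs hz hcrit
    rwa [← eq_thetaT_of_isCriticalT hν hsmall hz hcrit]
  · rwa [thetaT_of_atom hν hb]

/-- When the scale is 0, `thetaT ν R` lies outside Θ and is not an approximate minimizer itself. The
limit theorem is applied instead to pairs of a law `R` near `Q` and an approximate minimizer for
`R`; a closed neighborhood then also contains the limit `thetaT ν R`. -/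
theorem continuous_thetaT {ν : ℝ} (hν : 1 < ν) : Continuous (thetaT ν) := by
  have hlim : ∀ Q : ProbabilityMeasure ℝ,
      Tendsto id (approxMin (meanHT ν (Q : Measure ℝ))) (𝓝 (thetaT ν Q)) := fun Q =>
    tendsto_approximate_minimizers hν _ (Qs := fun _ => Q) tendsto_const_nhds
      (eventually_approxMin_pos _) fun p hp ε hε => eventually_approxMin_le _ hp hε
  refine continuous_iff_continuousAt.2 fun Q => ?_
  let 𝓛 : Filter (ProbabilityMeasure ℝ × (ℝ × ℝ)) :=
    (𝓝 Q).bind fun R => (approxMin (meanHT ν (R : Measure ℝ))).map fun φ => (R, φ)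
  have hmem : ∀ {P : ProbabilityMeasure ℝ × (ℝ × ℝ) → Prop}, (∀ᶠ x in 𝓛, P x) ↔
      ∀ᶠ R in 𝓝 Q, ∀ᶠ φ in approxMin (meanHT ν (R : Measure ℝ)), P (R, φ) := by
    intro P
    simp only [𝓛, eventually_bind, eventually_map]
  have hmain : Tendsto Prod.snd 𝓛 (𝓝 (thetaT ν Q)) := by
    refine tendsto_approximate_minimizers hν 𝓛 (Qs := Prod.fst) ?_ ?_ ?_
    · intro V hV
      exact hmem.2 ((show ∀ᶠ R in 𝓝 Q, R ∈ V from hV).mono fun R hR => Eventually.of_forall fun _ => hR)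
    · exact hmem.2 (Eventually.of_forall fun R => eventually_approxMin_pos _)
    · exact fun p hp ε hε => hmem.2 (Eventually.of_forall fun R => eventually_approxMin_le _ hp hε)
  refine (closed_nhds_basis (thetaT ν Q)).tendsto_right_iff.2 fun V ⟨hV, hVc⟩ => ?_
  filter_upwards [hmem.1 (hmain hV)] with R hR
  exact hVc.mem_of_tendsto (hlim R) hR

/-- The extended M-functional is a well separated approximate minimizer. -/
theorem thetaT_separated {ν : ℝ} (hν : 1 < ν) (Q : ProbabilityMeasure ℝ) {U : Set (ℝ × ℝ)}
    (hU : U ∈ 𝓝 (thetaT ν Q)) :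
    ∃ a b : ℝ, a < b ∧ (∃ᶠ φ in 𝓝[locScale] (thetaT ν Q), meanHT ν (Q : Measure ℝ) φ < a) ∧
      ∀ φ ∈ locScale \ U, b ≤ meanHT ν (Q : Measure ℝ) φ := by
  set F := meanHT ν (Q : Measure ℝ)
  have hlim : approxMin F ≤ 𝓝[locScale] (thetaT ν Q) := by
    refine tendsto_nhdsWithin_iff.2 ⟨?_, eventually_approxMin_pos F⟩
    exact tendsto_approximate_minimizers hν _ (Qs := fun _ => Q) tendsto_const_nhds
      (eventually_approxMin_pos _) fun p hp ε hε => eventually_approxMin_le _ hp hε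
  obtain ⟨c, ⟨p, hp, hpc⟩, hcU⟩ :=
    (hasBasis_approxMin F).mem_iff.1 (hlim (nhdsWithin_le_nhds hU))
  -- Some sublevel set `{F < c}` lies in `U`, so `F ≥ c` outside; a level strictly between `F p` and
  -- `c` is still undercut arbitrarily close to `thetaT`.
  refine ⟨(F p + c) / 2, c, by linarith, ?_, fun φ hφ => ?_⟩
  · have h : ∀ᶠ φ in approxMin F, F φ < (F p + c) / 2 :=
      (hasBasis_approxMin F).eventually_iff.2
        ⟨(F p + c) / 2, ⟨p, hp, by linarith⟩, fun _ hφ => hφ.2⟩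
    exact h.frequently.filter_mono hlim
  · exact le_of_not_gt fun h => hφ.2 (hcU ⟨hφ.1, h⟩)

/-! ### From real integrals to extended integrals and M-functionals -/

theorem extIntegral_eq_coe {Q : Measure ℝ} {f : ℝ → ℝ} (hf : Integrable f Q) :
    extIntegral Q f = ((∫ x, f x ∂Q : ℝ) : EReal) := by
  have h1 : ∫⁻ x, ENNReal.ofReal (f x) ∂Q ≠ ⊤ := hf.lintegral_lt_top.ne
  have h2 : ∫⁻ x, ENNReal.ofReal (-f x) ∂Q ≠ ⊤ := hf.neg.lintegral_lt_top.ne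
  rw [extIntegral, integral_eq_lintegral_pos_part_sub_lintegral_neg_part hf, EReal.coe_sub,
    EReal.coe_ennreal_toReal h1, EReal.coe_ennreal_toReal h2]

theorem extIntegralDefined_of_integrable {Q : Measure ℝ} {f : ℝ → ℝ} (hf : Integrable f Q) :
    ExtIntegralDefined Q f :=
  ⟨hf.aemeasurable, Or.inl hf.lintegral_lt_top.ne⟩

theorem extIntegral_hT {ν : ℝ} (hν : 0 < ν) (Q : ProbabilityMeasure ℝ) {φ : ℝ × ℝ}
    (hφ : 0 < φ.2) :
    extIntegral (Q : Measure ℝ) (fun x => hT ν x φ) = (meanHT ν (Q : Measure ℝ) φ : EReal) :=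
  extIntegral_eq_coe (integrable_hT hν hφ Q)

theorem isExtMFunctional_thetaT {ν : ℝ} (hν : 1 < ν) (Q : ProbabilityMeasure ℝ) :
    IsExtMFunctional (hT ν) (Q : Measure ℝ) (thetaT ν Q) := by
  have hν0 : 0 < ν := by linarith
  refine ⟨thetaT_mem_closure hν Q,
    fun φ hφ => extIntegralDefined_of_integrable (integrable_hT hν0 hφ Q), fun U hU => ?_⟩
  obtain ⟨a, b, hab, hfreq, hout⟩ := thetaT_separated hν Q hU
  have h1 : liminf (fun φ => extIntegral (Q : Measure ℝ) (fun x => hT ν x φ))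
      (𝓝[locScale] (thetaT ν Q)) ≤ (a : EReal) := by
    refine liminf_le_of_frequently_le' ?_
    refine (hfreq.and_eventually self_mem_nhdsWithin).mono fun φ hφ => ?_
    rw [extIntegral_hT hν0 Q hφ.2]
    exact_mod_cast hφ.1.le
  refine h1.trans_lt ((EReal.coe_lt_coe_iff.2 hab).trans_le ?_)
  refine le_iInf₂ fun φ hφ => ?_
  rw [extIntegral_hT hν0 Q hφ.1]
  exact_mod_cast hout φ hφ

theorem IsExtMFunctional.unique {h : ℝ → ℝ × ℝ → ℝ} {Q : Measure ℝ} {s t : ℝ × ℝ}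
    (hs : IsExtMFunctional h Q s) (ht : IsExtMFunctional h Q t) : s = t := by
  by_contra hne
  obtain ⟨U, V, hU, hV, hsU, htV, hUV⟩ := t2_separation hne
  set G := fun φ : ℝ × ℝ => extIntegral Q (fun x => h x φ)
  -- The lower limit at one point is at least the infimum outside a neighborhood of the other; the
  -- two strict inequalities then contradict each other.
  have key : ∀ {s t : ℝ × ℝ} {U V : Set (ℝ × ℝ)}, Disjoint U V → V ∈ 𝓝 t →
      ⨅ φ ∈ locScale \ U, G φ ≤ liminf G (𝓝[locScale] t) := by
    intro s t U V hd hV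
    refine le_liminf_of_le (by isBoundedDefault) ?_
    filter_upwards [self_mem_nhdsWithin, nhdsWithin_le_nhds hV] with φ h1 h2
    exact iInf₂_le φ ⟨h1, fun h3 => hd.ne_of_mem h3 h2 rfl⟩
  have h1 := (hs.2.2 U (hU.mem_nhds hsU)).trans_le (key (s := s) hUV (hV.mem_nhds htV))
  have h2 := (ht.2.2 V (hV.mem_nhds htV)).trans_le (key (s := t) hUV.symm (hU.mem_nhds hsU))
  exact lt_asymm h1 h2

theorem isMFunctional_thetaT {ν : ℝ} (hν : 1 < ν) {Q : ProbabilityMeasure ℝ}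
    (hQ : Q ∈ smallAtomLaws ν) : IsMFunctional (rhoT ν) (Q : Measure ℝ) (thetaT ν Q) := by
  have hν0 : 0 < ν := by linarith
  have heq : ∀ {φ : ℝ × ℝ}, 0 < φ.2 →
      (fun x => rhoT ν x φ - rhoT ν x (0, 1)) = fun x => hT ν x φ :=
    fun hφ => funext fun x => rhoT_eq hν0 x hφ
  refine ⟨(thetaT_spec hν hQ).1, fun x => rhoT ν x (0, 1), ?_, fun φ hφ => ?_, fun φ hφ hne => ?_⟩
  · unfold rhoT; fun_prop
  · rw [heq hφ, extIntegral_hT hν0 Q hφ]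
    exact ⟨extIntegralDefined_of_integrable (integrable_hT hν0 hφ Q), EReal.bot_lt_coe _⟩
  · rw [heq hφ, heq (thetaT_spec hν hQ).1, extIntegral_hT hν0 Q hφ,
      extIntegral_hT hν0 Q (thetaT_spec hν hQ).1]
    exact EReal.coe_lt_coe_iff.2 (meanHT_thetaT_lt hν hQ hφ hne)

/-! ### Maximum likelihood estimates and almost sure convergence -/

theorem integral_empiricalLaw (x : ℕ → ℝ) (n : ℕ) (f : ℝ → ℝ) :
    ∫ y, f y ∂(empiricalLaw x n : Measure ℝ) =
      ((n + 1 : ℕ) : ℝ)⁻¹ * ∑ i ∈ Finset.range (n + 1), f (x i) := by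
  have h : (empiricalLaw x n : Measure ℝ) =
    ((n + 1 : ℕ) : ENNReal)⁻¹ • ∑ i ∈ Finset.range (n + 1), Measure.dirac (x i) := rfl
  rw [h, integral_smul_measure, integral_finsetSum_measure fun i _ => integrable_dirac (by simp),
    ENNReal.toReal_inv, ENNReal.toReal_natCast, smul_eq_mul]
  simp only [integral_dirac]

theorem log_tDensity {ν : ℝ} (hν : 0 < ν) (x : ℝ) {θ : ℝ × ℝ} (hθ : 0 < θ.2) :
    Real.log (tDensity ν θ x) = Real.log (tDensity ν (0, 1) x) - hT ν x θ := by
  have key : ∀ {θ : ℝ × ℝ}, 0 < θ.2 → Real.log (tDensity ν θ x) =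
      Real.log (Real.Gamma ((ν + 1) / 2)) -
        Real.log (Real.sqrt (ν * Real.pi) * Real.Gamma (ν / 2)) - rhoT ν x θ := by
    intro θ hθ
    have g1 := Real.Gamma_pos_of_pos (by linarith : 0 < (ν + 1) / 2)
    have g2 := Real.Gamma_pos_of_pos (by linarith : 0 < ν / 2)
    have g3 : 0 < Real.sqrt (ν * Real.pi) := Real.sqrt_pos.2 (by positivity)
    have g4 : 0 < 1 + (x - θ.1) ^ 2 / (ν * θ.2 ^ 2) := by positivity
    rw [tDensity, Real.log_mul (by positivity) (by positivity), Real.log_rpow g4,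
      Real.log_div g1.ne' (by positivity), Real.log_mul (by positivity) hθ.ne', rhoT]
    ring
  rw [key hθ, key (by norm_num : (0 : ℝ) < ((0 : ℝ), (1 : ℝ)).2), ← rhoT_eq hν x hθ]
  ring

/-- The log likelihood is a decreasing affine function of `Q_n h_ν`, so maximizing it in the upper
limit sense is the extended M-problem for the empirical law. -/
theorem logLikelihood_eq {ν : ℝ} (hν : 0 < ν) (x : ℕ → ℝ) (n : ℕ) {θ : ℝ × ℝ} (hθ : 0 < θ.2) :
    logLikelihood ν x (n + 1) θ = logLikelihood ν x (n + 1) (0, 1) -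
      ((n + 1 : ℕ) : ℝ) * meanHT ν (empiricalLaw x n : Measure ℝ) θ := by
  rw [meanHT, integral_empiricalLaw x n, ← mul_assoc,
    mul_inv_cancel₀ (by positivity), one_mul, logLikelihood, logLikelihood,
    ← Finset.sum_sub_distrib]
  exact Finset.sum_congr rfl fun i _ => log_tDensity hν (x i) hθ

theorem isMaxLikelihoodEstimate_thetaT {ν : ℝ} (hν : 1 < ν) (x : ℕ → ℝ) (n : ℕ) :
    IsMaxLikelihoodEstimate ν x (n + 1) (thetaT ν (empiricalLaw x n)) := by
  have hν0 : 0 < ν := by linarith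
  refine ⟨thetaT_mem_closure hν _, fun U hU => ?_⟩
  obtain ⟨a, b, hab, hfreq, hout⟩ := thetaT_separated hν _ hU
  have hn : (0 : ℝ) < ((n + 1 : ℕ) : ℝ) := by positivity
  set C := logLikelihood ν x (n + 1) (0, 1)
  have h1 : ((C - ((n + 1 : ℕ) : ℝ) * a : ℝ) : EReal) ≤
      limsup (fun φ => (logLikelihood ν x (n + 1) φ : EReal))
        (𝓝[locScale] (thetaT ν (empiricalLaw x n))) := by
    refine le_limsup_of_frequently_le' ?_
    refine (hfreq.and_eventually self_mem_nhdsWithin).mono fun φ hφ => ?_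
    rw [logLikelihood_eq hν0 x n hφ.2, EReal.coe_le_coe_iff]
    have := mul_le_mul_of_nonneg_left hφ.1.le hn.le
    linarith
  have h2 : (⨆ φ ∈ locScale \ U, (logLikelihood ν x (n + 1) φ : EReal)) ≤
      ((C - ((n + 1 : ℕ) : ℝ) * b : ℝ) : EReal) := by
    refine iSup₂_le fun φ hφ => ?_
    rw [logLikelihood_eq hν0 x n hφ.1, EReal.coe_le_coe_iff]
    have := mul_le_mul_of_nonneg_left (hout φ hφ) hn.le
    linarith
  refine h2.trans_lt ((EReal.coe_lt_coe_iff.2 ?_).trans_le h1)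
  have := mul_lt_mul_of_pos_left hab hn
  linarith

/-- The empirical laws of i.i.d. real random variables converge weakly to their law, almost
surely. -/
theorem ae_tendsto_empiricalLaw {Ω : Type*} [MeasurableSpace Ω] {P : Measure Ω}
    [IsProbabilityMeasure P] {Q : ProbabilityMeasure ℝ} {X : ℕ → Ω → ℝ}
    (hX : ∀ i, Measurable (X i)) (hind : iIndepFun X P)
    (hlaw : ∀ i, P.map (X i) = (Q : Measure ℝ)) :
    ∀ᵐ ω ∂P, Tendsto (fun n => empiricalLaw (fun i => X i ω) n) atTop (𝓝 Q) := by
  -- Rational open intervals form a countable π-system containing arbitrarily small neighborhoods,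
  -- so the strong law on each of them, on one almost sure event, gives weak convergence.
  let S : Set (Set ℝ) := Set.range fun p : ℚ × ℚ => Set.Ioo (p.1 : ℝ) (p.2 : ℝ)
  have hS : S.Countable := Set.countable_range _
  have hmeas : ∀ s ∈ S, MeasurableSet s := by
    rintro _ ⟨p, rfl⟩; exact measurableSet_Ioo
  have hpi : IsPiSystem S := by
    rintro _ ⟨p, rfl⟩ _ ⟨q, rfl⟩ -
    refine ⟨(max p.1 q.1, min p.2 q.2), ?_⟩
    simp [Set.Ioo_inter_Ioo]
  have hnhds : ∀ u : Set ℝ, IsOpen u → ∀ x ∈ u, ∃ s ∈ S, s ∈ 𝓝 x ∧ s ⊆ u := by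
    intro u hu x hx
    obtain ⟨a, b, hab, hsub⟩ := mem_nhds_iff_exists_Ioo_subset.1 (hu.mem_nhds hx)
    obtain ⟨p, hp1, hp2⟩ := exists_rat_btwn hab.1
    obtain ⟨q, hq1, hq2⟩ := exists_rat_btwn hab.2
    exact ⟨_, ⟨(p, q), rfl⟩, Ioo_mem_nhds hp2 hq1,
      (Set.Ioo_subset_Ioo hp1.le hq2.le).trans hsub⟩
  have hlln : ∀ s ∈ S, ∀ᵐ ω ∂P,
      Tendsto (fun n => empiricalLaw (fun i => X i ω) n s) atTop (𝓝 (Q s)) := by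
    intro s hs
    have hsm := hmeas s hs
    let g : ℝ → ℝ := s.indicator fun _ => 1
    have hg : Measurable g := measurable_const.indicator hsm
    have hident : ∀ i, IdentDistrib (X i) (X 0) P P := fun i =>
      ⟨(hX i).aemeasurable, (hX 0).aemeasurable, by rw [hlaw, hlaw]⟩
    have hb : ∀ y, ‖g y‖ ≤ 1 := fun y => by
      by_cases h : y ∈ s <;> simp [g, h]
    have hslln := strong_law_ae_real (μ := P) (fun i => g ∘ X i)
      (Integrable.of_bound (hg.comp (hX 0)).aestronglyMeasurable 1
        (ae_of_all _ fun ω => hb _))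
      (fun i j hij => (hind.indepFun hij).comp hg hg) fun i => (hident i).comp hg
    have hE : ∫ ω, (g ∘ X 0) ω ∂P = (Q : Measure ℝ).real s := by
      have := integral_map (μ := P) (hX 0).aemeasurable (f := g) hg.aestronglyMeasurable
      rw [hlaw 0, integral_indicator_const _ hsm, smul_eq_mul, mul_one] at this
      exact this.symm
    rw [hE] at hslln
    filter_upwards [hslln] with ω hω
    -- The strong law averages the first `n` terms, whereas `empiricalLaw x n` uses `n + 1`.
    have h1 := hω.comp (tendsto_add_atTop_nat 1)
    refine NNReal.tendsto_coe.1 (h1.congr fun n => ?_)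
    have h2 := integral_empiricalLaw (fun i => X i ω) n g
    rw [integral_indicator_const _ hsm, smul_eq_mul, mul_one] at h2
    simp only [Function.comp_apply]
    rw [div_eq_inv_mul]
    exact h2.symm
  filter_upwards [(ae_ball_iff hS).2 hlln] with ω hω
  exact hpi.tendsto_probabilityMeasure_of_tendsto_of_mem hmeas hnhds hω

/-! ### Multiplication of bounded Lipschitz functions -/

theorem BL.ext {f g : BL} (h : ∀ x : ℝ, f x = g x) : f = g := Subtype.ext (funext h)

theorem BL.abs_sub_le (f : BL) (x y : ℝ) : |f x - f y| ≤ ‖f‖ * |x - y| := by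
  rcases eq_or_ne x y with rfl | h
  · simp
  · have hpos : 0 < |x - y| := abs_pos.2 (sub_ne_zero.2 h)
    rw [← div_le_iff₀ hpos]
    exact (le_ciSup f.bddAbove_slope (x, y)).trans (le_add_of_nonneg_left f.iSup_abs_nonneg)

theorem BL.norm_le (f : BL) {A B : ℝ} (hA : ∀ x, |f x| ≤ A) (hB0 : 0 ≤ B)
    (hB : ∀ x y, |f x - f y| ≤ B * |x - y|) : ‖f‖ ≤ A + B := by
  rw [BL.norm_def]
  refine add_le_add (ciSup_le hA) (ciSup_le fun p => ?_)
  exact div_le_of_le_mul₀ (abs_nonneg _) hB0 (hB p.1 p.2)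

theorem BL.abs_mul_sub_mul_le (f g : BL) (x y : ℝ) :
    |f x * g x - f y * g y| ≤ 2 * (‖f‖ * ‖g‖) * |x - y| := by
  have e : f x * g x - f y * g y = f x * (g x - g y) + (f x - f y) * g y := by ring
  rw [e]
  refine (abs_add_le _ _).trans ?_
  rw [abs_mul, abs_mul]
  have h1 := mul_le_mul (f.abs_apply_le x) (g.abs_sub_le x y) (abs_nonneg _) (norm_nonneg _)
  have h2 := mul_le_mul (f.abs_sub_le x y) (g.abs_apply_le y) (abs_nonneg _) (by positivity)
  nlinarith

theorem BL.abs_mul_le (f g : BL) (x : ℝ) : |f x * g x| ≤ ‖f‖ * ‖g‖ := by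
  rw [abs_mul]
  exact mul_le_mul (f.abs_apply_le x) (g.abs_apply_le x) (abs_nonneg _) (norm_nonneg _)

/-- The product of two bounded Lipschitz functions. -/
def BL.mul (f g : BL) : BL :=
  ⟨fun x => f x * g x, ⟨_, f.abs_mul_le g⟩, _, f.abs_mul_sub_mul_le g⟩

/-- Multiplication of bounded Lipschitz functions as a continuous bilinear map. -/
noncomputable def BL.mulL : BL →L[ℝ] BL →L[ℝ] BL :=
  LinearMap.mkContinuous₂
    (LinearMap.mk₂ ℝ BL.mul
      (fun f f' g => BL.ext fun x => add_mul (f x) (f' x) (g x))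
      (fun c f g => BL.ext fun x => mul_assoc c (f x) (g x))
      (fun f g g' => BL.ext fun x => mul_add (f x) (g x) (g' x))
      (fun c f g => BL.ext fun x => mul_left_comm (f x) c (g x))) 3 fun f g => by
    refine ((BL.mul f g).norm_le (f.abs_mul_le g) (by positivity)
      (f.abs_mul_sub_mul_le g)).trans (le_of_eq ?_)
    ring

theorem BL.mulL_apply (f g : BL) (x : ℝ) : BL.mulL f g x = f x * g x := rfl

/-- The transposed multiplication: the action of `f` on the dual of `BL`,
`(f • φ) g = φ (f g)`. -/
noncomputable def BL.dualMul : BL →L[ℝ] (BL →L[ℝ] ℝ) →L[ℝ] (BL →L[ℝ] ℝ) :=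
  (ContinuousLinearMap.compL ℝ BL BL ℝ).flip.comp BL.mulL

theorem BL.dualMul_apply (f g : BL) (φ : BL →L[ℝ] ℝ) : BL.dualMul f φ g = φ (BL.mulL f g) := rfl

theorem BL.dualMul_mul_eq_one {f g : BL} (h : ∀ x, f x * g x = 1) :
    BL.dualMul f * BL.dualMul g = 1 := by
  ext φ k
  change φ (BL.mulL g (BL.mulL f k)) = φ k
  congr 1
  refine BL.ext fun x => ?_
  rw [BL.mulL_apply, BL.mulL_apply]
  linear_combination k x * h x

/-- The constant function `1`. -/
noncomputable def BL.one : BL := ⟨fun _ => 1, ⟨1, by simp⟩, 0, by simp⟩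

/-- The function `1 / (1 + x²)`. -/
noncomputable def BL.kernel : BL :=
  ⟨fun x => 1 / (1 + x ^ 2), ⟨1, fun x => by
      rw [abs_of_pos (by positivity), div_le_one (by positivity)]
      nlinarith [sq_nonneg x]⟩, 1, fun x y => by
    have e : 1 / (1 + x ^ 2) - 1 / (1 + y ^ 2) =
        (-(x + y) / ((1 + x ^ 2) * (1 + y ^ 2))) * (x - y) := by
      field_simp; ring
    rw [e, abs_mul]
    refine mul_le_mul_of_nonneg_right ?_ (abs_nonneg _)
    rw [abs_div, abs_of_pos (by positivity : 0 < (1 + x ^ 2) * (1 + y ^ 2)),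
      div_le_one (by positivity), abs_le]
    constructor <;> nlinarith [sq_nonneg (x + y - 1), sq_nonneg (x + y + 1), sq_nonneg (x * y),
      sq_nonneg (x - y), sq_nonneg x, sq_nonneg y, sq_nonneg (x - 1), sq_nonneg (y - 1),
      sq_nonneg (x + 1), sq_nonneg (y + 1)]⟩

/-- The function `x / (1 + x²)`. -/
noncomputable def BL.conjKernel : BL :=
  ⟨fun x => x / (1 + x ^ 2), ⟨1, fun x => by
      rw [abs_div, abs_of_pos (by positivity : 0 < 1 + x ^ 2), div_le_one (by positivity), abs_le]
      constructor <;> nlinarith [sq_nonneg (x - 1), sq_nonneg (x + 1)]⟩, 1, fun x y => by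
    have e : x / (1 + x ^ 2) - y / (1 + y ^ 2) =
        ((1 - x * y) / ((1 + x ^ 2) * (1 + y ^ 2))) * (x - y) := by
      field_simp; ring
    rw [e, abs_mul]
    refine mul_le_mul_of_nonneg_right ?_ (abs_nonneg _)
    rw [abs_div, abs_of_pos (by positivity : 0 < (1 + x ^ 2) * (1 + y ^ 2)),
      div_le_one (by positivity), abs_le]
    constructor <;> nlinarith [sq_nonneg (x * y), sq_nonneg (x - y), sq_nonneg (x + y),
      sq_nonneg x, sq_nonneg y]⟩

/-- The function `((x - μ)² + ν σ²) / (1 + x²)`. -/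
noncomputable def BL.quad (ν : ℝ) (θ : ℝ × ℝ) : BL :=
  BL.one - (2 * θ.1) • BL.conjKernel + (θ.1 ^ 2 + ν * θ.2 ^ 2 - 1) • BL.kernel

theorem BL.quad_apply (ν : ℝ) (θ : ℝ × ℝ) (x : ℝ) :
    BL.quad ν θ x = quadT ν x θ / (1 + x ^ 2) := by
  change 1 - 2 * θ.1 * (x / (1 + x ^ 2)) + (θ.1 ^ 2 + ν * θ.2 ^ 2 - 1) * (1 / (1 + x ^ 2)) = _
  simp only [quadT]
  field_simp
  ring

theorem BL.exists_inverse (f : BL) {ε : ℝ} (hε : 0 < ε) (hf : ∀ x, ε ≤ f x) :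
    ∃ g : BL, ∀ x, g x = 1 / f x := by
  refine ⟨⟨fun x => 1 / f x, ⟨1 / ε, fun x => ?_⟩, ‖f‖ / ε ^ 2, fun x y => ?_⟩, fun x => rfl⟩
  · have := hε.trans_le (hf x)
    rw [abs_of_pos (by positivity)]
    exact one_div_le_one_div_of_le hε (hf x)
  · have hx := hε.trans_le (hf x)
    have hy := hε.trans_le (hf y)
    have e : 1 / f x - 1 / f y = (f y - f x) / (f x * f y) := by field_simp
    rw [e, abs_div, abs_of_pos (mul_pos hx hy), abs_sub_comm, div_mul_eq_mul_div]
    refine div_le_div₀ (by positivity) (f.abs_sub_le x y) (by positivity) ?_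
    rw [sq]
    exact mul_le_mul (hf x) (hf y) hε.le hx.le

/-- Dividing the quadratic by `1 + x²` makes it a bounded Lipschitz function that is also bounded
away from 0, hence invertible in the algebra `BL`. -/
theorem BL.exists_inverse_quad {ν : ℝ} (hν : 0 < ν) {θ : ℝ × ℝ} (hθ : 0 < θ.2) :
    ∃ g : BL, ∀ x, g x = (1 + x ^ 2) / quadT ν x θ := by
  have hle : ∀ x : ℝ, 1 + x ^ 2 ≤ (2 + (1 + 2 * θ.1 ^ 2) / (ν * θ.2 ^ 2)) * quadT ν x θ := by
    intro x
    have hs : 0 < ν * θ.2 ^ 2 := by positivity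
    have h1 : 1 + 2 * θ.1 ^ 2 ≤ (1 + 2 * θ.1 ^ 2) / (ν * θ.2 ^ 2) * quadT ν x θ := by
      rw [div_mul_eq_mul_div, le_div_iff₀ hs]
      have : ν * θ.2 ^ 2 ≤ quadT ν x θ := by unfold quadT; nlinarith [sq_nonneg (x - θ.1)]
      gcongr
    have h2 : x ^ 2 ≤ 2 * quadT ν x θ + 2 * θ.1 ^ 2 := by
      unfold quadT; nlinarith [sq_nonneg (x - 2 * θ.1)]
    linarith
  set K := 2 + (1 + 2 * θ.1 ^ 2) / (ν * θ.2 ^ 2)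
  have hK : 0 < K := by positivity
  obtain ⟨g, hg⟩ := (BL.quad ν θ).exists_inverse (ε := 1 / K) (by positivity) fun x => by
    rw [BL.quad_apply, div_le_div_iff₀ hK (by positivity)]
    linarith [hle x]
  exact ⟨g, fun x => by rw [hg, BL.quad_apply, one_div_div]⟩

/-! ### The estimating equations on the dual space -/

/-- The functional `φ` divided by `BL.quad ν θ`. -/
noncomputable def dualQuot (ν : ℝ) (p : (BL →L[ℝ] ℝ) × (ℝ × ℝ)) : BL →L[ℝ] ℝ :=
  Ring.inverse (BL.dualMul (BL.quad ν p.2)) p.1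

/-- The left-hand sides of the equations for a critical point, as functions of an element of the
dual of `BL` and of the parameter. -/
noncomputable def scoreMap (ν : ℝ) (p : (BL →L[ℝ] ℝ) × (ℝ × ℝ)) : ℝ × ℝ :=
  (dualQuot ν p BL.conjKernel - p.2.1 * dualQuot ν p BL.kernel,
    (ν + 1) * p.2.2 ^ 2 * dualQuot ν p BL.kernel - 1)

theorem exists_dualMul_inverse {ν : ℝ} (hν : 0 < ν) {θ : ℝ × ℝ} (hθ : 0 < θ.2) :
    ∃ g : BL, (∀ x, g x = (1 + x ^ 2) / quadT ν x θ) ∧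
      IsUnit (BL.dualMul (BL.quad ν θ)) ∧
      Ring.inverse (BL.dualMul (BL.quad ν θ)) = BL.dualMul g := by
  obtain ⟨g, hg⟩ := BL.exists_inverse_quad hν hθ
  have h1 : ∀ x, g x * BL.quad ν θ x = 1 := fun x => by
    have := (quadT_pos hν x hθ).ne'
    rw [hg, BL.quad_apply]; field_simp
  have h2 : ∀ x, BL.quad ν θ x * g x = 1 := fun x => by rw [mul_comm, h1]
  let u : ((BL →L[ℝ] ℝ) →L[ℝ] (BL →L[ℝ] ℝ))ˣ :=
    ⟨BL.dualMul (BL.quad ν θ), BL.dualMul g, BL.dualMul_mul_eq_one h2, BL.dualMul_mul_eq_one h1⟩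
  exact ⟨g, hg, u.isUnit, Ring.inverse_unit u⟩

theorem lawFunctional_apply (Q : ProbabilityMeasure ℝ) (f : BL) :
    lawFunctional Q f = ∫ x, f x ∂(Q : Measure ℝ) := rfl

/-- The factor `1 + x²` of the inverse of `BL.quad` cancels against the denominators of `BL.kernel`
and `BL.conjKernel`. -/
theorem scoreMap_lawFunctional {ν : ℝ} (hν : 0 < ν) (Q : ProbabilityMeasure ℝ) {θ : ℝ × ℝ}
    (hθ : 0 < θ.2) : scoreMap ν (lawFunctional Q, θ) =
      (locScore ν (Q : Measure ℝ) θ, (ν + 1) * θ.2 ^ 2 * invScore ν (Q : Measure ℝ) θ - 1) := by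
  obtain ⟨g, hg, -, hinv⟩ := exists_dualMul_inverse hν hθ
  have h0 : dualQuot ν (lawFunctional Q, θ) BL.kernel = invScore ν (Q : Measure ℝ) θ := by
    rw [dualQuot, hinv, BL.dualMul_apply, lawFunctional_apply, invScore]
    refine integral_congr_ae (ae_of_all _ fun x => ?_)
    simp only [BL.mulL_apply, hg]
    change (1 + x ^ 2) / quadT ν x θ * (1 / (1 + x ^ 2)) = _
    field_simp
  have h1 : dualQuot ν (lawFunctional Q, θ) BL.conjKernel -
      θ.1 * dualQuot ν (lawFunctional Q, θ) BL.kernel = locScore ν (Q : Measure ℝ) θ := by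
    have e : dualQuot ν (lawFunctional Q, θ) BL.conjKernel =
        ∫ x, x / quadT ν x θ ∂(Q : Measure ℝ) := by
      rw [dualQuot, hinv, BL.dualMul_apply, lawFunctional_apply]
      refine integral_congr_ae (ae_of_all _ fun x => ?_)
      simp only [BL.mulL_apply, hg]
      change (1 + x ^ 2) / quadT ν x θ * (x / (1 + x ^ 2)) = _
      field_simp
    have hx : (fun x => x / quadT ν x θ) = fun x =>
        (x - θ.1) / quadT ν x θ + θ.1 * (1 / quadT ν x θ) := by
      funext x; ring
    rw [e, h0, hx, integral_add (integrable_loc_quadT hν hθ Q)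
      ((integrable_inv_quadT hν hθ Q).const_mul _), integral_const_mul]
    simp [locScore, invScore]
  simp only [scoreMap, h0] at h1 ⊢
  rw [h1]

/-- `BL.quad` is polynomial in θ, multiplication is continuous linear, and inversion is analytic at
units of a Banach algebra. The order `⊤` in `WithTop ℕ∞` means analyticity. -/
theorem contDiffAt_scoreMap {ν : ℝ} (hν : 0 < ν) {p : (BL →L[ℝ] ℝ) × (ℝ × ℝ)}
    (hp : 0 < p.2.2) : ContDiffAt ℝ ⊤ (scoreMap ν) p := by
  obtain ⟨-, -, hu, -⟩ := exists_dualMul_inverse hν hp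
  obtain ⟨u, hu⟩ := hu
  have h1 : ContDiff ℝ ⊤ fun p : (BL →L[ℝ] ℝ) × (ℝ × ℝ) => BL.dualMul (BL.quad ν p.2) := by
    have hq : ContDiff ℝ ⊤ fun p : (BL →L[ℝ] ℝ) × (ℝ × ℝ) => BL.quad ν p.2 := by
      unfold BL.quad
      fun_prop
    have hm : ContDiff ℝ ⊤ fun f : BL => BL.dualMul f :=
      ContinuousLinearMap.contDiff (𝕜 := ℝ) (E := BL)
        (F := (BL →L[ℝ] ℝ) →L[ℝ] (BL →L[ℝ] ℝ)) BL.dualMul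
    exact hm.comp hq
  have h2 : ContDiffAt ℝ ⊤ (fun p : (BL →L[ℝ] ℝ) × (ℝ × ℝ) =>
      Ring.inverse (BL.dualMul (BL.quad ν p.2))) p := by
    have h := contDiffAt_ringInverse ℝ (R := (BL →L[ℝ] ℝ) →L[ℝ] (BL →L[ℝ] ℝ)) u (n := ⊤)
    rw [hu] at h
    exact h.comp p h1.contDiffAt
  have h3 : ContDiffAt ℝ ⊤ (dualQuot ν) p := h2.clm_apply contDiffAt_fst
  have h4 : ∀ f : BL, ContDiffAt ℝ ⊤ (fun p => dualQuot ν p f) p := fun f =>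
    h3.clm_apply contDiffAt_const
  have h5 := h4 BL.kernel
  have h6 := h4 BL.conjKernel
  unfold scoreMap
  fun_prop

/-! ### Derivatives of the scores -/

theorem hasFDerivAt_inv_quadT {ν : ℝ} (hν : 0 < ν) (x : ℝ) {θ : ℝ × ℝ} (hθ : 0 < θ.2) :
    HasFDerivAt (fun η => 1 / quadT ν x η)
      ((2 * ((x - θ.1) / quadT ν x θ) * (1 / quadT ν x θ)) • ContinuousLinearMap.fst ℝ ℝ ℝ +
        (-2 * ν * θ.2 * (1 / quadT ν x θ) ^ 2) • ContinuousLinearMap.snd ℝ ℝ ℝ) θ := by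
  have hD := (quadT_pos hν x hθ).ne'
  have h := (hasDerivAt_inv hD).comp_hasFDerivAt θ (hasFDerivAt_quadT ν x θ)
  have h' : HasFDerivAt (fun η => 1 / quadT ν x η) _ θ :=
    h.congr_of_eventuallyEq (Eventually.of_forall fun η => one_div _)
  refine h'.congr_fderiv ?_
  ext <;> (simp; field_simp)

theorem hasFDerivAt_loc_quadT {ν : ℝ} (hν : 0 < ν) (x : ℝ) {θ : ℝ × ℝ} (hθ : 0 < θ.2) :
    HasFDerivAt (fun η : ℝ × ℝ => (x - η.1) / quadT ν x η)
      ((2 * ((x - θ.1) / quadT ν x θ) ^ 2 - 1 / quadT ν x θ) • ContinuousLinearMap.fst ℝ ℝ ℝ +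
        (-2 * ν * θ.2 * (((x - θ.1) / quadT ν x θ) * (1 / quadT ν x θ))) •
          ContinuousLinearMap.snd ℝ ℝ ℝ) θ := by
  have h1 : HasFDerivAt (fun θ : ℝ × ℝ => x - θ.1) (-ContinuousLinearMap.fst ℝ ℝ ℝ) θ :=
    (hasFDerivAt_fst (p := θ)).const_sub x
  have h' : HasFDerivAt (fun η : ℝ × ℝ => (x - η.1) / quadT ν x η) _ θ :=
    (h1.mul (hasFDerivAt_inv_quadT hν x hθ)).congr_of_eventuallyEq
      (Eventually.of_forall fun η => div_eq_mul_one_div _ _)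
  refine h'.congr_fderiv ?_
  ext
  · simp; ring
  · simp; ring

theorem inv_quadT_le_of_lt {ν : ℝ} (hν : 0 < ν) {σ : ℝ} {η : ℝ × ℝ} (hσ : 0 < σ)
    (hη : σ < η.2) (x : ℝ) : |1 / quadT ν x η| ≤ 1 / (ν * σ ^ 2) := by
  refine (inv_quadT_le hν x (by linarith)).trans ?_
  have := hη.le
  gcongr

theorem loc_quadT_le_of_lt {ν : ℝ} (hν : 0 < ν) {σ : ℝ} {η : ℝ × ℝ} (hσ : 0 < σ)
    (hη : σ < η.2) (x : ℝ) : |(x - η.1) / quadT ν x η| ≤ 1 + 1 / (ν * σ ^ 2) := by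
  refine (loc_quadT_le hν x (by linarith)).trans ?_
  have := hη.le
  gcongr

theorem hasFDerivAt_invScore {ν : ℝ} (hν : 0 < ν) (Q : ProbabilityMeasure ℝ) {θ : ℝ × ℝ}
    (hθ : 0 < θ.2) : HasFDerivAt (invScore ν (Q : Measure ℝ))
    ((∫ x, 2 * ((x - θ.1) / quadT ν x θ) * (1 / quadT ν x θ) ∂(Q : Measure ℝ)) •
        ContinuousLinearMap.fst ℝ ℝ ℝ +
      (∫ x, -2 * ν * θ.2 * (1 / quadT ν x θ) ^ 2 ∂(Q : Measure ℝ)) •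
        ContinuousLinearMap.snd ℝ ℝ ℝ) θ := by
  have c0 := continuous_inv_quadT hν hθ
  have c1 := continuous_loc_quadT hν hθ
  set K := 1 / (ν * (θ.2 / 2) ^ 2)
  refine hasFDerivAt_integral_pair Q (f := fun x η => 1 / quadT ν x η)
    (a := fun x η => 2 * ((x - η.1) / quadT ν x η) * (1 / quadT ν x η))
    (b := fun x η => -2 * ν * η.2 * (1 / quadT ν x η) ^ 2)
    (A := 2 * (1 + K) * K) (B := 2 * ν * (2 * θ.2) * K ^ 2)
    (scale_mem_nhds hθ) (fun η hη => integrable_inv_quadT hν (by linarith [hη.1]) Q)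
    ((c1.const_mul 2).mul c0) ((c0.pow 2).const_mul _)
    (fun x η hη => hasFDerivAt_inv_quadT hν x (by linarith [hη.1])) ?_ ?_
  · intro x η hη
    have k0 := inv_quadT_le_of_lt hν (half_pos hθ) hη.1 x
    have k1 := loc_quadT_le_of_lt hν (half_pos hθ) hη.1 x
    rw [abs_mul, abs_mul, abs_two]
    gcongr
  · intro x η hη
    have k0 := inv_quadT_le_of_lt hν (half_pos hθ) hη.1 x
    have hη0 : 0 < η.2 := by linarith [hη.1]
    have h2 := hη.2.le
    rw [abs_mul, abs_pow, neg_mul, neg_mul, abs_neg, abs_of_pos (by positivity : 0 < 2 * ν * η.2)]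
    gcongr

theorem hasFDerivAt_locScore {ν : ℝ} (hν : 0 < ν) (Q : ProbabilityMeasure ℝ) {θ : ℝ × ℝ}
    (hθ : 0 < θ.2) : HasFDerivAt (locScore ν (Q : Measure ℝ))
    ((∫ x, (2 * ((x - θ.1) / quadT ν x θ) ^ 2 - 1 / quadT ν x θ) ∂(Q : Measure ℝ)) •
        ContinuousLinearMap.fst ℝ ℝ ℝ +
      (∫ x, -2 * ν * θ.2 * (((x - θ.1) / quadT ν x θ) * (1 / quadT ν x θ)) ∂(Q : Measure ℝ)) •
        ContinuousLinearMap.snd ℝ ℝ ℝ) θ := by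
  have c0 := continuous_inv_quadT hν hθ
  have c1 := continuous_loc_quadT hν hθ
  set K := 1 / (ν * (θ.2 / 2) ^ 2)
  refine hasFDerivAt_integral_pair Q (f := fun x η => (x - η.1) / quadT ν x η)
    (a := fun x η => 2 * ((x - η.1) / quadT ν x η) ^ 2 - 1 / quadT ν x η)
    (b := fun x η => -2 * ν * η.2 * (((x - η.1) / quadT ν x η) * (1 / quadT ν x η)))
    (A := 2 * (1 + K) ^ 2 + K) (B := 2 * ν * (2 * θ.2) * ((1 + K) * K))
    (scale_mem_nhds hθ) (fun η hη => integrable_loc_quadT hν (by linarith [hη.1]) Q)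
    (((c1.pow 2).const_mul 2).sub c0) ((c1.mul c0).const_mul _)
    (fun x η hη => hasFDerivAt_loc_quadT hν x (by linarith [hη.1])) ?_ ?_
  · intro x η hη
    have k0 := inv_quadT_le_of_lt hν (half_pos hθ) hη.1 x
    have k1 := loc_quadT_le_of_lt hν (half_pos hθ) hη.1 x
    refine (abs_sub _ _).trans ?_
    rw [abs_mul, abs_two, abs_pow]
    gcongr
  · intro x η hη
    have k0 := inv_quadT_le_of_lt hν (half_pos hθ) hη.1 x
    have k1 := loc_quadT_le_of_lt hν (half_pos hθ) hη.1 x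
    have hη0 : 0 < η.2 := by linarith [hη.1]
    have h2 := hη.2.le
    rw [abs_mul, abs_mul _ (1 / quadT ν x η), neg_mul, neg_mul, abs_neg,
      abs_of_pos (by positivity : 0 < 2 * ν * η.2)]
    gcongr

/-- At a critical point the derivative of the scores is injective. -/
theorem scores_derivative_injective {ν : ℝ} (hν : 1 < ν) {Q : ProbabilityMeasure ℝ}
    (hQ : ∀ t : ℝ, (Q : Measure ℝ).real {t} < 1) {θ : ℝ × ℝ} (hθ : 0 < θ.2)
    (hcrit : IsCriticalT ν (Q : Measure ℝ) θ) {L : ℝ × ℝ →L[ℝ] ℝ × ℝ}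
    (hL : HasFDerivAt (fun η : ℝ × ℝ => (locScore ν (Q : Measure ℝ) η,
      (ν + 1) * η.2 ^ 2 * invScore ν (Q : Measure ℝ) η - 1)) L θ) :
    Function.Injective L := by
  have hν0 : 0 < ν := by linarith
  have c0 := continuous_inv_quadT hν0 hθ
  have c1 := continuous_loc_quadT hν0 hθ
  have b0 := fun x => inv_quadT_le hν0 x hθ
  have b1 := fun x => loc_quadT_le hν0 x hθ
  have i0 := integrable_inv_quadT hν0 hθ Q
  have i1 := integrable_loc_quadT hν0 hθ Q
  have i00 : Integrable (fun x => (1 / quadT ν x θ) ^ 2) (Q : Measure ℝ) := by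
    simp only [sq]
    exact i0.bdd_mul c0.aestronglyMeasurable (ae_of_all _ b0)
  have i11 : Integrable (fun x => ((x - θ.1) / quadT ν x θ) ^ 2) (Q : Measure ℝ) := by
    simp only [sq]
    exact i1.bdd_mul c1.aestronglyMeasurable (ae_of_all _ b1)
  have i10 : Integrable (fun x => ((x - θ.1) / quadT ν x θ) * (1 / quadT ν x θ))
      (Q : Measure ℝ) := i0.bdd_mul c1.aestronglyMeasurable (ae_of_all _ b1)
  set A := ∫ x, ((x - θ.1) / quadT ν x θ) ^ 2 ∂(Q : Measure ℝ) with hA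
  set B := ∫ x, ((x - θ.1) / quadT ν x θ) * (1 / quadT ν x θ) ∂(Q : Measure ℝ) with hB
  set C := ∫ x, (1 / quadT ν x θ) ^ 2 ∂(Q : Measure ℝ) with hC
  set J := invScore ν (Q : Measure ℝ) θ with hJ
  set σ := θ.2 with hσ
  have hlocs : ∫ x, (x - θ.1) / quadT ν x θ ∂(Q : Measure ℝ) = 0 := hcrit.1
  have hJ1 : (ν + 1) * σ ^ 2 * J = 1 := hcrit.2
  -- This integrates `1/D = ((x-μ)² + νσ²) / D²`, where `D = quadT`.
  have hJA : J = A + ν * σ ^ 2 * C := by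
    rw [hJ, hA, hC, invScore, ← integral_const_mul, ← integral_add i11 (i00.const_mul _)]
    refine integral_congr_ae (ae_of_all _ fun x => ?_)
    have := (quadT_pos hν0 x hθ).ne'
    simp only
    field_simp
    simp only [quadT, hσ]
  have hApos : 0 < A := by
    have hA0 : 0 ≤ A := integral_nonneg fun x => sq_nonneg _
    refine lt_of_le_of_ne hA0 fun h0 => ?_
    have hae := (integral_eq_zero_iff_of_nonneg (fun x => sq_nonneg _) i11).1 h0.symm
    have h3 : ∀ᵐ x ∂(Q : Measure ℝ), x ∈ ({θ.1} : Set ℝ) := by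
      filter_upwards [hae] with x hx
      have h4 : (x - θ.1) / quadT ν x θ = 0 := pow_eq_zero_iff two_ne_zero |>.1 hx
      rcases div_eq_zero_iff.1 h4 with h | h
      · exact sub_eq_zero.1 h
      · exact absurd h (quadT_pos hν0 x hθ).ne'
    have h4 := hQ θ.1
    rw [measureReal_def, (mem_ae_iff_prob_eq_one (measurableSet_singleton _)).1 h3] at h4
    simp at h4
  -- This is the integral of the square of `u(2νσ²/D - 1) + k(x-μ)/D`, expanded using the location
  -- equation.
  have hquad : ∀ u k : ℝ, 0 ≤ u ^ 2 * (4 * (ν * σ ^ 2) ^ 2 * C - 4 * (ν * σ ^ 2) * J + 1) +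
      4 * (ν * σ ^ 2) * B * u * k + k ^ 2 * A := by
    intro u k
    have h0 : 0 ≤ ∫ x, (u * (2 * (ν * σ ^ 2) * (1 / quadT ν x θ) - 1) +
        k * ((x - θ.1) / quadT ν x θ)) ^ 2 ∂(Q : Measure ℝ) := integral_nonneg fun x => sq_nonneg _
    have hexp : (fun x => (u * (2 * (ν * σ ^ 2) * (1 / quadT ν x θ) - 1) +
        k * ((x - θ.1) / quadT ν x θ)) ^ 2) = fun x =>
        ((((4 * u ^ 2 * (ν * σ ^ 2) ^ 2) * (1 / quadT ν x θ) ^ 2 +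
        (-(4 * u ^ 2 * (ν * σ ^ 2))) * (1 / quadT ν x θ)) +
        (k ^ 2 * ((x - θ.1) / quadT ν x θ) ^ 2 +
        (4 * u * k * (ν * σ ^ 2)) * (((x - θ.1) / quadT ν x θ) * (1 / quadT ν x θ)))) +
        ((-(2 * u * k)) * ((x - θ.1) / quadT ν x θ) + u ^ 2)) := by
      funext x; ring
    have j1 : Integrable (fun x => (4 * u ^ 2 * (ν * σ ^ 2) ^ 2) * (1 / quadT ν x θ) ^ 2 +
        (-(4 * u ^ 2 * (ν * σ ^ 2))) * (1 / quadT ν x θ)) (Q : Measure ℝ) :=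
      (i00.const_mul _).add (i0.const_mul _)
    have j2 : Integrable (fun x => k ^ 2 * ((x - θ.1) / quadT ν x θ) ^ 2 +
        (4 * u * k * (ν * σ ^ 2)) * (((x - θ.1) / quadT ν x θ) * (1 / quadT ν x θ)))
        (Q : Measure ℝ) := (i11.const_mul _).add (i10.const_mul _)
    have j3 : Integrable (fun x => (-(2 * u * k)) * ((x - θ.1) / quadT ν x θ) + u ^ 2)
        (Q : Measure ℝ) := (i1.const_mul _).add (integrable_const _)
    have j12 : Integrable (fun x => ((4 * u ^ 2 * (ν * σ ^ 2) ^ 2) * (1 / quadT ν x θ) ^ 2 +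
        (-(4 * u ^ 2 * (ν * σ ^ 2))) * (1 / quadT ν x θ)) +
        (k ^ 2 * ((x - θ.1) / quadT ν x θ) ^ 2 +
        (4 * u * k * (ν * σ ^ 2)) * (((x - θ.1) / quadT ν x θ) * (1 / quadT ν x θ))))
        (Q : Measure ℝ) := j1.add j2
    rw [hexp, integral_add j12 j3, integral_add j1 j2,
      integral_add (i00.const_mul _) (i0.const_mul _),
      integral_add (i11.const_mul _) (i10.const_mul _),
      integral_add (i1.const_mul _) (integrable_const _)] at h0
    simp only [integral_const_mul, hlocs, integral_const, probReal_univ, smul_eq_mul] at h0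
    rw [← hC, ← hA, ← hB] at h0
    have hJ' : ∫ x, 1 / quadT ν x θ ∂(Q : Measure ℝ) = J := rfl
    rw [hJ'] at h0
    linarith
  have d1 := hasFDerivAt_locScore hν0 Q hθ
  have d2 : HasFDerivAt (fun η : ℝ × ℝ => (ν + 1) * η.2 ^ 2 * invScore ν (Q : Measure ℝ) η - 1) _
      θ := ((((hasFDerivAt_snd (p := θ)).pow 2).const_mul (ν + 1)).mul
        (hasFDerivAt_invScore hν0 Q hθ)).sub_const 1
  have hLeq := hL.unique (d1.prodMk d2)
  rw [injective_iff_map_eq_zero]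
  rintro ⟨u, v⟩ huv
  rw [hLeq] at huv
  have e1 : ∫ x, (2 * ((x - θ.1) / quadT ν x θ) ^ 2 - 1 / quadT ν x θ) ∂(Q : Measure ℝ) =
      2 * A - J := by
    rw [integral_sub (i11.const_mul _) i0, integral_const_mul]; rfl
  have e2 : ∫ x, -2 * ν * σ * (((x - θ.1) / quadT ν x θ) * (1 / quadT ν x θ)) ∂(Q : Measure ℝ) =
      -2 * ν * σ * B := integral_const_mul _ _
  have e3 : ∫ x, 2 * ((x - θ.1) / quadT ν x θ) * (1 / quadT ν x θ) ∂(Q : Measure ℝ) = 2 * B := by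
    simp only [mul_assoc]; exact integral_const_mul _ _
  have e4 : ∫ x, -2 * ν * σ * (1 / quadT ν x θ) ^ 2 ∂(Q : Measure ℝ) = -2 * ν * σ * C :=
    integral_const_mul _ _
  rw [e1, e2, e3, e4] at huv
  have f1 := congrArg Prod.fst huv
  have f2 := congrArg Prod.snd huv
  simp [← hJ, ← hσ] at f1 f2
  have g1 : (2 * A - J) * u - 2 * ν * σ * B * v = 0 := by linear_combination f1
  have g2 : A * v + σ * B * u = 0 := by
    have : 2 * (ν + 1) * σ * (A * v + σ * B * u) = 0 := by
      linear_combination f2 - 2 * (ν + 1) * σ * v * hJA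
    have h2 : 2 * (ν + 1) * σ ≠ 0 := by positivity
    exact (mul_eq_zero.1 this).resolve_left h2
  -- By the scale equation `2νσ²J - 1 = (ν-1)/(ν+1)`, positive because `ν > 1`.
  have hτJ : (ν + 1) * (2 * (ν * σ ^ 2) * J - 1) = ν - 1 := by linear_combination 2 * ν * hJ1
  have hκ : 0 < 2 * (ν * σ ^ 2) * J - 1 := by
    have : 0 < (ν + 1) * (2 * (ν * σ ^ 2) * J - 1) := by rw [hτJ]; linarith
    exact (pos_iff_pos_of_mul_pos this).1 (by linarith)
  -- On the kernel of the derivative, a positive multiple of `u²` plus the nonnegative form of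
  -- `hquad` at `k = 2νσv` vanishes. So `u = 0`, and then `Av = 0` with `A > 0`, as `Q` is not a
  -- point mass.
  have hsum : (2 * (ν * σ ^ 2) * J - 1) * u ^ 2 +
      (u ^ 2 * (4 * (ν * σ ^ 2) ^ 2 * C - 4 * (ν * σ ^ 2) * J + 1) +
      4 * (ν * σ ^ 2) * B * u * (2 * ν * σ * v) + (2 * ν * σ * v) ^ 2 * A) = 0 := by
    linear_combination (-2 * ν * σ ^ 2 * u) * g1 + 4 * ν ^ 2 * σ ^ 2 * v * g2 -
      4 * ν * σ ^ 2 * u ^ 2 * hJA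
  have hu : u = 0 := by
    have := hquad u (2 * ν * σ * v)
    by_contra hne
    have : 0 < (2 * (ν * σ ^ 2) * J - 1) * u ^ 2 := by positivity
    linarith
  rw [hu, mul_zero, add_zero] at g2
  have hv : v = 0 := (mul_eq_zero.1 g2).resolve_left hApos.ne'
  rw [hu, hv]
  rfl

/-! ### The implicit function and its analytic continuation -/

/-- Analytic functions on balls which agree near the centers of the balls are restrictions of
an analytic function on a neighborhood of all centers. -/
theorem exists_analytic_gluing {E F ι : Type*} [NormedAddCommGroup E] [NormedSpace ℝ E]
    [NormedAddCommGroup F] [NormedSpace ℝ F] (c : ι → E) (r : ι → ℝ) (g : ι → E → F)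
    (hr : ∀ i, 0 < r i) (hg : ∀ i, AnalyticOnNhd ℝ (g i) (Metric.ball (c i) (r i)))
    (hcompat : ∀ i j, c j ∈ Metric.ball (c i) (r i) → g i =ᶠ[𝓝 (c j)] g j) :
    ∃ (O : Set E) (G : E → F), IsOpen O ∧ AnalyticOnNhd ℝ G O ∧
      ∀ i, c i ∈ O ∧ G (c i) = g i (c i) := by
  classical
  -- If two balls of one third radius meet, the one belonging to the smaller radius lies in the full
  -- ball of the other. The identity theorem on this convex set spreads the agreement near its
  -- center.
  have key : ∀ i j x, r j ≤ r i → x ∈ Metric.ball (c i) (r i / 3) →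
      x ∈ Metric.ball (c j) (r j / 3) → g i x = g j x := by
    intro i j x hji hxi hxj
    have hd : dist (c j) (c i) < r i / 3 + r j / 3 := by
      have := dist_triangle (c j) x (c i)
      rw [Metric.mem_ball] at hxi hxj
      rw [dist_comm] at hxj
      linarith
    have hsub : Metric.ball (c j) (r j / 3) ⊆ Metric.ball (c i) (r i) :=
      Metric.ball_subset_ball' (by linarith)
    have hsub' : Metric.ball (c j) (r j / 3) ⊆ Metric.ball (c j) (r j) :=
      Metric.ball_subset_ball (by linarith [hr j])
    have hmem : c j ∈ Metric.ball (c j) (r j / 3) := Metric.mem_ball_self (by linarith [hr j])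
    exact ((hg i).mono hsub).eqOn_of_preconnected_of_eventuallyEq ((hg j).mono hsub')
      (convex_ball _ _).isPreconnected hmem (hcompat i j (hsub hmem)) hxj
  let G : E → F := fun x =>
    if h : ∃ i, x ∈ Metric.ball (c i) (r i / 3) then g h.choose x else 0
  have hG : ∀ i, ∀ x ∈ Metric.ball (c i) (r i / 3), G x = g i x := by
    intro i x hx
    have h : ∃ i, x ∈ Metric.ball (c i) (r i / 3) := ⟨i, hx⟩
    simp only [G, dif_pos h]
    rcases le_total (r i) (r h.choose) with hle | hle
    · exact key _ _ x hle h.choose_spec hx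
    · exact (key _ _ x hle hx h.choose_spec).symm
  refine ⟨⋃ i, Metric.ball (c i) (r i / 3), G, isOpen_iUnion fun i => Metric.isOpen_ball, ?_, ?_⟩
  · intro x hx
    obtain ⟨i, hi⟩ := Set.mem_iUnion.1 hx
    refine (hg i x (Metric.ball_subset_ball (by linarith [hr i]) hi)).congr ?_
    filter_upwards [Metric.isOpen_ball.mem_nhds hi] with y hy
    exact (hG i y hy).symm
  · intro i
    have hmem : c i ∈ Metric.ball (c i) (r i / 3) := Metric.mem_ball_self (by linarith [hr i])
    exact ⟨Set.mem_iUnion.2 ⟨i, hmem⟩, hG i _ hmem⟩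

theorem scoreMap_eq_zero_iff {ν : ℝ} (hν : 0 < ν) (Q : ProbabilityMeasure ℝ) {θ : ℝ × ℝ}
    (hθ : 0 < θ.2) :
    scoreMap ν (lawFunctional Q, θ) = 0 ↔ IsCriticalT ν (Q : Measure ℝ) θ := by
  rw [scoreMap_lawFunctional hν Q hθ, Prod.ext_iff, IsCriticalT]
  simp [sub_eq_zero]

theorem isInvertible_of_injective {L : ℝ × ℝ →L[ℝ] ℝ × ℝ} (hL : Function.Injective L) :
    L.IsInvertible :=
  ⟨(LinearEquiv.ofInjectiveEndo (L : ℝ × ℝ →ₗ[ℝ] ℝ × ℝ) hL).toContinuousLinearEquiv, by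
    ext <;> rfl⟩

/-- Near a law with small atoms the critical point is an analytic function on the dual of `BL`. -/
theorem exists_local_analytic {ν : ℝ} (hν : 1 < ν) {Q : ProbabilityMeasure ℝ}
    (hQ : Q ∈ smallAtomLaws ν) : ∃ g : (BL →L[ℝ] ℝ) → ℝ × ℝ, ∃ r > 0,
      AnalyticOnNhd ℝ g (Metric.ball (lawFunctional Q) r) ∧
      g (lawFunctional Q) = thetaT ν Q ∧
      (∀ φ ∈ Metric.ball (lawFunctional Q) r, 0 < (g φ).2 ∧ scoreMap ν (φ, g φ) = 0) ∧
      ∀ᶠ p in 𝓝 (lawFunctional Q, thetaT ν Q), scoreMap ν p = 0 → g p.1 = p.2 := by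
  have hν0 : 0 < ν := by linarith
  have hpos := (thetaT_spec hν hQ).1
  have hcrit := isCriticalT_thetaT hν hQ
  set u : (BL →L[ℝ] ℝ) × (ℝ × ℝ) := (lawFunctional Q, thetaT ν Q) with hu
  have hzero : scoreMap ν u = 0 := (scoreMap_eq_zero_iff hν0 Q hpos).2 hcrit
  have cdf : ContDiffAt ℝ ⊤ (scoreMap ν) u := contDiffAt_scoreMap hν0 hpos
  have hinv : (fderiv ℝ (scoreMap ν) u ∘L .inr ℝ (BL →L[ℝ] ℝ) (ℝ × ℝ)).IsInvertible := by
    refine isInvertible_of_injective (scores_derivative_injective hν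
      (lt_one_of_mem_smallAtomLaws hν hQ) hpos hcrit ?_)
    have h1 : HasFDerivAt (scoreMap ν) (fderiv ℝ (scoreMap ν) u) u :=
      (cdf.differentiableAt (by simp)).hasFDerivAt
    have h2 := h1.comp (thetaT ν Q) (hasFDerivAt_prodMk_right (lawFunctional Q) (thetaT ν Q))
    refine h2.congr_of_eventuallyEq ?_
    filter_upwards [(isOpen_lt continuous_const continuous_snd).mem_nhds hpos] with η hη
    exact (scoreMap_lawFunctional hν0 Q hη).symm
  have htop : (⊤ : WithTop ℕ∞) ≠ 0 := by simp
  set g := cdf.implicitFunction htop hinv with hg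
  have hself : g (lawFunctional Q) = thetaT ν Q := cdf.implicitFunction_apply_self htop hinv
  have han : AnalyticAt ℝ g (lawFunctional Q) :=
    (cdf.contDiffAt_implicitFunction htop hinv).analyticAt
  have hev := cdf.eventually_apply_implicitFunction htop hinv
  have hev2 : ∀ᶠ φ in 𝓝 (lawFunctional Q), 0 < (g φ).2 := by
    have : Tendsto g (𝓝 (lawFunctional Q)) (𝓝 (thetaT ν Q)) := by
      simpa [hself] using han.continuousAt.tendsto
    exact this.eventually ((isOpen_lt continuous_const continuous_snd).mem_nhds hpos)
  obtain ⟨r, hr, hball⟩ := Metric.eventually_nhds_iff_ball.1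
    (han.eventually_analyticAt.and (hev.and hev2))
  refine ⟨g, r, hr, fun φ hφ => (hball φ hφ).1, hself,
    fun φ hφ => ⟨(hball φ hφ).2.2, (hball φ hφ).2.1.trans hzero⟩, ?_⟩
  filter_upwards [cdf.eventually_apply_eq_iff_implicitFunction htop hinv] with p hp h0
  exact hp.1 (h0.trans hzero.symm)

/-- At a law in the domain of another branch, that branch takes the value of the critical point,
since the latter is unique. By continuity its graph stays near this zero of `scoreMap`, where the
implicit function theorem makes it coincide with the local branch. -/
theorem analyticForDualBL_thetaT {ν : ℝ} (hν : 1 < ν) :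
    AnalyticForDualBL (thetaT ν) (smallAtomLaws ν) := by
  have hν0 : 0 < ν := by linarith
  choose g r hr han hself hscore huniq using
    fun Q : smallAtomLaws ν => exists_local_analytic hν Q.2
  have hval : ∀ Q R : smallAtomLaws ν,
      lawFunctional (R : ProbabilityMeasure ℝ) ∈ Metric.ball (lawFunctional (Q : _)) (r Q) →
      g Q (lawFunctional (R : ProbabilityMeasure ℝ)) = thetaT ν R := by
    intro Q R hR
    obtain ⟨h1, h2⟩ := hscore Q _ hR
    exact eq_thetaT_of_isCriticalT hν R.2 h1 ((scoreMap_eq_zero_iff hν0 _ h1).1 h2)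
  have hcompat : ∀ Q R : smallAtomLaws ν,
      lawFunctional (R : ProbabilityMeasure ℝ) ∈ Metric.ball (lawFunctional (Q : _)) (r Q) →
      g Q =ᶠ[𝓝 (lawFunctional (R : ProbabilityMeasure ℝ))] g R := by
    intro Q R hR
    have hcont : Tendsto (fun φ => (φ, g Q φ)) (𝓝 (lawFunctional (R : ProbabilityMeasure ℝ)))
        (𝓝 (lawFunctional (R : ProbabilityMeasure ℝ), thetaT ν R)) := by
      have h := (han Q _ hR).continuousAt.tendsto
      rw [hval Q R hR] at h
      exact tendsto_id.prodMk_nhds h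
    filter_upwards [hcont.eventually (huniq R), Metric.isOpen_ball.mem_nhds hR] with φ h1 h2
    exact (h1 (hscore Q φ h2).2).symm
  obtain ⟨O, G, hO, hG, hc⟩ := exists_analytic_gluing
    (fun Q : smallAtomLaws ν => lawFunctional (Q : ProbabilityMeasure ℝ)) r g hr han hcompat
  exact ⟨O, G, hO, hG, fun Q hQ => ⟨(hc ⟨Q, hQ⟩).1, (hc ⟨Q, hQ⟩).2.trans (hself ⟨Q, hQ⟩)⟩⟩

/-! ### The theorem -/

theorem theorem9p1 (ν : ℝ) (hν : 1 < ν) :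
    -- the integrals defining `Q h_ν` exist
    (∀ (Q : ProbabilityMeasure ℝ), ∀ φ ∈ locScale,
      Integrable (fun x => hT ν x φ) (Q : Measure ℝ)) ∧
    ∃ θ : ProbabilityMeasure ℝ → ℝ × ℝ,
      -- every law has a (unique) extended M-functional `θ Q = (μ_ν, σ_ν)(Q)`
      (∀ (Q : ProbabilityMeasure ℝ) (t : ℝ × ℝ),
        IsExtMFunctional (hT ν) (Q : Measure ℝ) t ↔ t = θ Q) ∧
      -- laws with small atoms: M-functional with positive scale, unique critical point
      (∀ Q ∈ smallAtomLaws ν,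
        IsMFunctional (rhoT ν) (Q : Measure ℝ) (θ Q) ∧
        0 < (θ Q).2 ∧
        HasFDerivAt (meanHT ν (Q : Measure ℝ)) (0 : ℝ × ℝ →L[ℝ] ℝ) (θ Q) ∧
        ∀ μ σ : ℝ, 0 < σ →
          HasDerivAt (fun m => meanHT ν (Q : Measure ℝ) (m, σ)) 0 μ →
          HasDerivAt (fun s => meanHT ν (Q : Measure ℝ) (μ, s)) 0 σ →
          (μ, σ) = θ Q) ∧
      AnalyticForDualBL θ (smallAtomLaws ν) ∧
      ContinuousOn θ (smallAtomLaws ν) ∧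
      -- laws with a large atom
      (∀ (Q : ProbabilityMeasure ℝ) (s : ℝ),
        ν / (ν + 1) ≤ (Q : Measure ℝ).real {s} → θ Q = (s, 0)) ∧
      -- weak continuity at every law
      Continuous θ ∧
      -- maximum likelihood estimates
      (∀ (Q : ProbabilityMeasure ℝ) (Ω : Type*) [MeasurableSpace Ω] (P : Measure Ω)
        [IsProbabilityMeasure P] (X : ℕ → Ω → ℝ),
        (∀ i, Measurable (X i)) → iIndepFun X P → (∀ i, P.map (X i) = (Q : Measure ℝ)) →
        (∀ (n : ℕ) (ω : Ω), IsMaxLikelihoodEstimate ν (fun i => X i ω) (n + 1)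
          (θ (empiricalLaw (fun i => X i ω) n))) ∧
        ∀ᵐ ω ∂P, Tendsto (fun n => θ (empiricalLaw (fun i => X i ω) n)) atTop (𝓝 (θ Q))) := by
  have hν0 : 0 < ν := by linarith
  refine ⟨fun Q φ hφ => integrable_hT hν0 hφ Q, thetaT ν, fun Q t => ⟨fun h =>
    h.unique (isExtMFunctional_thetaT hν Q), fun h => h ▸ isExtMFunctional_thetaT hν Q⟩,
    fun Q hQ => ⟨isMFunctional_thetaT hν hQ, (thetaT_spec hν hQ).1,
      (isCriticalT_thetaT hν hQ).hasFDerivAt hν0 (thetaT_spec hν hQ).1,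
      fun μ σ hσ h1 h2 => eq_thetaT_of_isCriticalT hν hQ hσ
        (isCriticalT_of_hasDerivAt hν0 Q hσ h1 h2)⟩,
    analyticForDualBL_thetaT hν, (continuous_thetaT hν).continuousOn,
    fun Q s hs => thetaT_of_atom hν hs, continuous_thetaT hν, ?_⟩
  intro Q Ω _ P _ X hX hind hlaw
  refine ⟨fun n ω => isMaxLikelihoodEstimate_thetaT hν (fun i => X i ω) n, ?_⟩
  filter_upwards [ae_tendsto_empiricalLaw hX hind hlaw] with ω hω
  exact ((continuous_thetaT hν).tendsto Q).comp hω
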